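/- For a finite simple graph $G$ on vertex set $[n]$ and $x\in\{\pm1\}^{[n]}$, let $\mathrm{val}_G(x)$ be the number of edges of $G$ whose endpoints receive different signs, let $\mathrm{OPT}_G=\max_x \mathrm{val}_G(x)$, and let $d(v)$ be the degree of $v$ in $G$. For $\alpha>0$ and $\varepsilon>0$, let $\mathcal A_{\alpha,\varepsilon}$ be the following randomized algorithm on input $G$. 1. For each $v\in[n]$ draw independent Laplace noise $z_v$ of scale $12/\varepsilon$; let $V_1=\{v: d(v)+z_v>24/\varepsilon^{1+\alpha}\}$ and $V_2=[n]\setminus V_1$. Let $G_1$ and $\widetilde G$ be the subgraphs of $G$ induced on $V_1$ and $V_2$. 2. Draw $S_1^A\in\{\pm1\}^{V_1}$ with probability proportional to $\exp(\varepsilon\,\mathrm{val}_{G_1}(S_1^A)/12)$ and $S_1^B\in\{\pm1\}^{V_2}$ uniformly; $S_1$ is their concatenation. 3. Keep each edge of $\widetilde G$ independently with probability $\varepsilon^{1+\alpha}/70$, giving $G_2$. Each $v\in V_2$ that is not isolated in $G_2$ chooses independently a uniformly random neighbor $f(v)$ in $G_2$. Let $G_M$ be the graph on $V_2$ whose edges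 are the edges $\{u,v\}$ of $G_2$ with $f(u)=v$ and $f(v)=u$. Draw $S_2^A\in\{\pm1\}^{V_2}$ with probability proportional to $\exp(2.5\,\mathrm{val}_{G_M}(S_2^A)/4)$ and $S_2^B\in\{\pm1\}^{V_1}$ uniformly; $S_2$ is their concatenation. 4. Let $S_3$ be the cut $(V_1,V_2)$. Output $S_i$, where $i\in\{1,2,3\}$ is drawn with probability proportional to $\exp(\varepsilon\,\mathrm{val}_G(S_i)/4)$. **Theorem.** There are absolute constants $C,c>0$ such that the following holds. (1) Let $\alpha>0$ and $0<\varepsilon\le 0.1$ satisfy $$\varepsilon^\alpha\le\min\Bigl\{0.0106,\ \frac{1.8}{\ln(10/\varepsilon^{1+\alpha})}\Bigr\}.$$ Then for every $n$, $\mathcal A_{\alpha,\varepsilon}$ is $\varepsilon$-differentially private (that is, $(\varepsilon,0)$-DP) on graphs with vertex set $[n]$, where two graphs are neighboring if they differ in at most one edge; and for every graph $G$ on $[n]$ with $m\ge C/\varepsilon^2$ edges, the output $S$ satisfies $$\mathbb E[\mathrm{val}_G(S)]\ \ge\ \Bigl(\tfrac12+c\,\varepsilon^{1+\alpha}\Bigr)\mathrm{OPT}_G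 .$$ (2) Let $0<\varepsilon\le 0.1$ and $\alpha=\log_{1/\varepsilon}\bigl(\ln(1/\varepsilon)/0.0106\bigr)$. Then $\alpha>0$, the condition displayed in (1) holds, and $\varepsilon^{1+\alpha}=0.0106\,\varepsilon/\ln(1/\varepsilon)$. Consequently, for every $n$, $\mathcal A_{\alpha,\varepsilon}$ is $\varepsilon$-differentially private, and for every graph $G$ on $[n]$ with $m\ge C/\varepsilon^2$ edges its output $S$ satisfies $$\mathbb E[\mathrm{val}_G(S)]\ \ge\ \Bigl(\tfrac12+c\,\frac{\varepsilon}{\ln(1/\varepsilon)}\Bigr)\mathrm{OPT}_G .$$ -/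

import Mathlib

open MeasureTheory
open scoped ENNReal

noncomputable section

namespace PrivateMaxCut

/-! ### Cuts of a graph -/

/-- A cut of the vertex set `V`: every vertex is put on one of two sides. -/
abbrev Cut (V : Type) : Type := V → Bool

/-- `val_G(x)`: the number of edges of `G` whose endpoints lie on different sides of `x`. -/
def cutValue {V : Type} (G : SimpleGraph V) (x : Cut V) : ℕ :=
  {e : Sym2 V | ∃ u v : V, e = s(u, v) ∧ G.Adj u v ∧ x u ≠ x v}.ncard

/-- `OPT_G`: the size of a maximum cut of `G`. -/
def maxCutValue {V : Type} [Fintype V] [DecidableEq V] (G : SimpleGraph V) : ℕ :=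
  Finset.univ.sup fun x : Cut V => cutValue G x

/-- The number of edges of `G`. -/
def edgeCount {V : Type} (G : SimpleGraph V) : ℕ := G.edgeSet.ncard

/-- The degree of `v` in `G`. -/
def vertexDegree {V : Type} (G : SimpleGraph V) (v : V) : ℕ := (G.neighborSet v).ncard

/-! ### Differential privacy -/

/-- `(ε, δ)`-differential privacy of a randomized algorithm `M`, given by its output laws, with
respect to the neighboring relation `nbr` on the inputs. -/
def IsDP {X O : Type} [MeasurableSpace O] (nbr : X → X → Prop) (M : X → Measure O)
    (ε δ : ℝ) : Prop :=
  ∀ d d' : X, nbr d d' → ∀ S : Set O, MeasurableSet S →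
    M d S ≤ ENNReal.ofReal (Real.exp ε) * M d' S + ENNReal.ofReal δ

/-- Edge-level neighbors: two graphs on the same vertex set that differ in at most one edge. -/
def EdgeNeighbors {V : Type} (G G' : SimpleGraph V) : Prop :=
  (symmDiff G.edgeSet G'.edgeSet).encard ≤ 1

/-! ### Elementary random choices -/

/-- The Laplace distribution with scale `b`, of density `exp (-|x| / b) / (2 b)`. -/
def laplace (b : ℝ) : Measure ℝ :=
  volume.withDensity fun x => ENNReal.ofReal (1 / (2 * b) * Real.exp (-|x| / b))

/-- The coin that shows `true` with probability `q` (for `q` in `[0, 1]`). -/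
def coin (q : ℝ) : PMF Bool :=
  PMF.ofFintype
    (fun b => bif b then min 1 (ENNReal.ofReal q) else 1 - min 1 (ENNReal.ofReal q))
    (by simp [add_tsub_cancel_of_le])

/-- The joint law of independent random variables with the laws `p i`. -/
def independent {ι : Type} [Fintype ι] [DecidableEq ι] {β : ι → Type} [∀ i, Fintype (β i)]
    (p : ∀ i, PMF (β i)) : PMF (∀ i, β i) :=
  PMF.ofFintype (fun f => ∏ i, p i (f i)) (by
    rw [← Fintype.piFinset_univ, ← Finset.prod_univ_sum]
    refine Finset.prod_eq_one fun i _ => ?_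
    rw [← (p i).tsum_coe, tsum_fintype])

/-- The law on the finite set `C` for which the probability of `c` is proportional to
`exp (rate * score c)`. The exponential mechanism with privacy budget `b` for a score of
sensitivity `s` is the case `rate = b / (2 * s)`. -/
def expMechanism {C : Type} [Fintype C] [Nonempty C] (rate : ℝ) (score : C → ℝ) : PMF C :=
  PMF.normalize (fun c => ENNReal.ofReal (Real.exp (rate * score c)))
    (by
      rw [tsum_fintype]
      have c₀ : C := Classical.arbitrary C
      intro h
      have h₀ := (Finset.sum_eq_zero_iff.mp h) c₀ (Finset.mem_univ _)
      exact absurd (ENNReal.ofReal_eq_zero.mp h₀) (not_le.mpr (Real.exp_pos _)))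
    (by
      rw [tsum_fintype]
      exact ENNReal.sum_ne_top.mpr fun _ _ => ENNReal.ofReal_ne_top)

/-! ### The algorithm -/

/-- The subgraph of `G` induced on the vertices that satisfy `P`. -/
def inducedOn {V : Type} (G : SimpleGraph V) (P : V → Prop) : SimpleGraph {v // P v} :=
  G.comap Subtype.val

/-- Keep every edge of `G` independently with probability `q`. (There is one coin for each unordered
pair of vertices; only the coins of the edges of `G` are looked at.) -/
def subsample {W : Type} [Fintype W] [DecidableEq W] (q : ℝ) (G : SimpleGraph W) :
    PMF (SimpleGraph W) :=
  (independent fun _ : Sym2 W => coin q).map fun keep =>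
    SimpleGraph.fromEdgeSet {e | e ∈ G.edgeSet ∧ keep e = true}

open Classical in
/-- A uniformly random neighbor of `v` in `G`, and `none` if `v` is isolated. -/
def chooseNeighbor {W : Type} [Fintype W] (G : SimpleGraph W) (v : W) : PMF (Option W) :=
  if h : (G.neighborFinset v).Nonempty then
    (PMF.uniformOfFinset (G.neighborFinset v) h).map some
  else PMF.pure none

/-- The edges `{u, v}` of `G` for which `u` and `v` choose each other. -/
def mutualChoices {W : Type} (G : SimpleGraph W) (f : W → Option W) : SimpleGraph W where
  Adj u v := G.Adj u v ∧ f u = some v ∧ f v = some u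
  symm := ⟨fun _ _ h => ⟨h.1.symm, h.2.2, h.2.1⟩⟩
  loopless := ⟨fun v h => G.loopless.irrefl v h.1⟩

/-- The random matching of a subsampled graph: keep each edge with probability `q`, let every vertex
choose a uniformly random neighbor among the kept edges, and match mutual choices. -/
def randomMatching {W : Type} [Fintype W] [DecidableEq W] (q : ℝ) (G : SimpleGraph W) :
    PMF (SimpleGraph W) := do
  let G₂ ← subsample q G
  let f ← independent fun v => chooseNeighbor G₂ v
  return mutualChoices G₂ f

/-- The concatenation of a cut of `V₁` and a cut of its complement. -/
def concatCut {V : Type} [DecidableEq V] (V₁ : Finset V) (a : Cut {v // v ∈ V₁})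
    (b : Cut {v // v ∉ V₁}) : Cut V :=
  fun v => if h : v ∈ V₁ then a ⟨v, h⟩ else b ⟨v, h⟩

/-- The part of the algorithm that follows the private partition of the vertices into `V₁` and
`V₂ = V \ V₁`. -/
def cutOfPartition {V : Type} [Fintype V] [DecidableEq V] (α ε : ℝ) (G : SimpleGraph V)
    (V₁ : Finset V) : PMF (Cut V) := do
  -- the cut `S₁`: exponential mechanism on the induced graph on `V₁`, uniform on `V₂`
  let a₁ ← expMechanism (ε / 12) fun x : Cut {v // v ∈ V₁} =>
    (cutValue (inducedOn G (· ∈ V₁)) x : ℝ)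
  let b₁ ← PMF.uniformOfFintype (Cut {v // v ∉ V₁})
  -- the cut `S₂`: exponential mechanism on the random matching inside `V₂`, uniform on `V₁`
  let GM ← randomMatching (ε ^ (1 + α) / 70) (inducedOn G (· ∉ V₁))
  let a₂ ← expMechanism (2.5 / 4) fun x : Cut {v // v ∉ V₁} => (cutValue GM x : ℝ)
  let b₂ ← PMF.uniformOfFintype (Cut {v // v ∈ V₁})
  -- the cut `S₃ = (V₁, V₂)` and the choice among `S₁`, `S₂`, `S₃` (budget `ε / 2`, sensitivity 1)
  let S : Fin 3 → Cut V :=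
    ![concatCut V₁ a₁ b₁, concatCut V₁ b₂ a₂, fun v => decide (v ∈ V₁)]
  let i ← expMechanism (ε / 2 / 2) fun i => (cutValue G (S i) : ℝ)
  return S i

/-- The vertices whose noisy degree `d(v) + z(v)` exceeds the threshold `24 / ε ^ (1 + α)`. -/
def highDegree {V : Type} [Fintype V] (α ε : ℝ) (G : SimpleGraph V) (z : V → ℝ) : Finset V :=
  Finset.univ.filter fun v => 24 / ε ^ (1 + α) < (vertexDegree G v : ℝ) + z v

/-- The law of the output of the private Max-Cut algorithm for general graphs, on input `G`: the
vertices are partitioned with independent Laplace noise of scale `12 / ε` on their degrees, and then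
the algorithm continues with `cutOfPartition`. -/
def privateMaxCut {V : Type} [Fintype V] [DecidableEq V] (α ε : ℝ) (G : SimpleGraph V) :
    Measure (Cut V) :=
  (Measure.pi fun _ : V => laplace (12 / ε)).bind fun z =>
    (cutOfPartition α ε G (highDegree α ε G z)).toMeasure

/-- The condition on `ε` and `α`. -/
def Admissible (α ε : ℝ) : Prop :=
  ε ^ α ≤ min 0.0106 (1.8 / Real.log (10 / ε ^ (1 + α)))

end PrivateMaxCut

end

open MeasureTheory
open scoped ENNReal

noncomputable section

namespace PrivateMaxCut

/-! ### Expectations under laws on finite types -/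

/-! Privacy. Output laws are compared point by point (`RatioLE`), and the factors multiply along the
stages. Let the edge `{u, v}` change. The noisy degrees of `u` and `v` cost `ε/12` each, hence `ε/6`
for the partition. For a fixed partition the edge lies inside at most one of the two parts, so only
one of `S₁`, `S₂` changes its law; this is budgeted at `ε/3`. The final selection costs `ε/2`. The
exponential mechanism on the matching has a constant rate, so on its own it would only be
`6.25`-private. An edge is sampled with probability `q` of order `ε ^ (1 + α)`, however, and
amplification by subsampling (`ratioLE_matchingCut`) brings the cost down to `ε/3`.

Utility. Let `m`, `a`, `d` count the edges of `G`, those inside `V₁` and those inside `V₂`, and let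
`η = ε ^ (1 + α)`. Selecting among three cuts loses at most `5/ε`. Three cases cover a good
partition (`target_le_partitionValue`): - If more than `0.55 m` edges cross, `S₃` alone is good
enough. - If few edges cross and `d ≥ 0.05 m`, the matching gives `S₂` a gain of order `η m` over
`m/2`. This gain can be far smaller than `5/ε`, so the selection loss needs another source. Since
`max x y = (x + y + |x - y|) / 2`, the fluctuation of the two random values pays for it: one of the
parts holds a constant fraction of the edges, one of the two cuts is uniform there, and Bonami's
fourth-moment bound gives a mean difference of order `√m` (`le_mean_abs_cutValue_sub`). This exceeds
the loss once `m ≥ C/ε²`. - If few edges cross and `d < 0.05 m`, then `a ≥ 0.4 m`. The exponential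
mechanism on `V₁` loses `O(1/ε)` per non-isolated vertex. Most of these vertices have degree at
least `2.4/η`, so there are few of them, and `S₁` has an advantage linear in `m`.

A partition is good if few low-degree vertices fall into `V₁` and few edges at high-degree vertices
stay inside `V₂`. Admissibility makes each misplacement have probability at most `η/20`. Bad
partitions still achieve `m/2` (`half_le_partitionValue`), and the slack in the good case covers
them on average (`target_le_integral`). -/

/-- The expectation of a real function under a probability mass function. -/
def mean {α : Type} (p : PMF α) (f : α → ℝ) : ℝ := ∑' a, (p a).toReal * f a

section Mean

variable {α β : Type}

theorem mean_eq_sum [Fintype α] (p : PMF α) (f : α → ℝ) :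
    mean p f = ∑ a, (p a).toReal * f a := tsum_fintype _

theorem sum_toReal [Fintype α] (p : PMF α) : ∑ a, (p a).toReal = 1 := by
  rw [← ENNReal.toReal_sum fun a _ => p.apply_ne_top a, ← tsum_fintype (L := .unconditional _), p.tsum_coe,
    ENNReal.toReal_one]

theorem mean_pure (a : α) (f : α → ℝ) : mean (PMF.pure a) f = f a := by
  classical
  rw [mean, tsum_eq_single a]
  · simp
  · intro b hb
    simp [PMF.pure_apply, hb]

theorem mean_bind [Finite α] [Finite β] (p : PMF α) (k : α → PMF β) (f : β → ℝ) :
    mean (p.bind k) f = mean p fun a => mean (k a) f := by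
  cases nonempty_fintype α
  cases nonempty_fintype β
  simp only [mean_eq_sum, PMF.bind_apply, tsum_fintype, Finset.mul_sum]
  rw [Finset.sum_comm]
  refine Finset.sum_congr rfl fun b _ => ?_
  rw [ENNReal.toReal_sum fun a _ => ENNReal.mul_ne_top (p.apply_ne_top a) ((k a).apply_ne_top b),
    Finset.sum_mul]
  exact Finset.sum_congr rfl fun a _ => by rw [ENNReal.toReal_mul, mul_assoc]

theorem mean_map [Finite α] [Finite β] (p : PMF α) (k : α → β) (f : β → ℝ) :
    mean (p.map k) f = mean p fun a => f (k a) := by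
  rw [← PMF.bind_pure_comp, mean_bind]
  simp only [Function.comp_apply, mean_pure]

theorem mean_congr (p : PMF α) {f g : α → ℝ} (h : ∀ a, p a ≠ 0 → f a = g a) :
    mean p f = mean p g := by
  refine tsum_congr fun a => ?_
  by_cases ha : p a = 0
  · simp [ha]
  · rw [h a ha]

theorem mean_mono [Finite α] (p : PMF α) {f g : α → ℝ} (h : ∀ a, f a ≤ g a) :
    mean p f ≤ mean p g := by
  cases nonempty_fintype α
  simp only [mean_eq_sum]
  exact Finset.sum_le_sum fun a _ => mul_le_mul_of_nonneg_left (h a) ENNReal.toReal_nonneg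

theorem mean_const [Finite α] (p : PMF α) (c : ℝ) : mean p (fun _ => c) = c := by
  cases nonempty_fintype α
  rw [mean_eq_sum, ← Finset.sum_mul, sum_toReal, one_mul]

theorem mean_nonneg (p : PMF α) {f : α → ℝ} (h : ∀ a, 0 ≤ f a) : 0 ≤ mean p f :=
  tsum_nonneg fun a => mul_nonneg ENNReal.toReal_nonneg (h a)

theorem mean_add [Finite α] (p : PMF α) (f g : α → ℝ) :
    mean p (fun a => f a + g a) = mean p f + mean p g := by
  cases nonempty_fintype α
  simp only [mean_eq_sum, mul_add, Finset.sum_add_distrib]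

theorem mean_add_const [Finite α] (p : PMF α) (f : α → ℝ) (c : ℝ) :
    mean p (fun a => f a + c) = mean p f + c := by
  rw [mean_add, mean_const]

theorem mean_sub [Finite α] (p : PMF α) (f g : α → ℝ) :
    mean p (fun a => f a - g a) = mean p f - mean p g := by
  cases nonempty_fintype α
  simp only [mean_eq_sum, mul_sub, Finset.sum_sub_distrib]

theorem mean_const_mul [Finite α] (p : PMF α) (c : ℝ) (f : α → ℝ) :
    mean p (fun a => c * f a) = c * mean p f := by
  cases nonempty_fintype α
  simp only [mean_eq_sum, Finset.mul_sum]
  exact Finset.sum_congr rfl fun a _ => by ring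

theorem mean_sum [Finite α] {ι : Type} (s : Finset ι) (p : PMF α) (f : ι → α → ℝ) :
    mean p (fun a => ∑ i ∈ s, f i a) = ∑ i ∈ s, mean p (f i) := by
  cases nonempty_fintype α
  simp only [mean_eq_sum, Finset.mul_sum]
  exact Finset.sum_comm

theorem abs_mean_le [Finite α] (p : PMF α) (f : α → ℝ) :
    |mean p f| ≤ mean p fun a => |f a| := by
  cases nonempty_fintype α
  simp only [mean_eq_sum]
  refine (Finset.abs_sum_le_sum_abs _ _).trans (Finset.sum_le_sum fun a _ => ?_)
  rw [abs_mul, abs_of_nonneg ENNReal.toReal_nonneg]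

theorem mean_uniform [Fintype α] [Nonempty α] (f : α → ℝ) :
    mean (PMF.uniformOfFintype α) f = (∑ a, f a) / Fintype.card α := by
  rw [mean_eq_sum, Finset.sum_div]
  refine Finset.sum_congr rfl fun a _ => ?_
  rw [PMF.uniformOfFintype_apply, ENNReal.toReal_inv, ENNReal.toReal_natCast, div_eq_inv_mul]

theorem mean_uniform_comp [Fintype α] [Nonempty α] (e : α ≃ α) (f : α → ℝ) :
    mean (PMF.uniformOfFintype α) (fun a => f (e a)) = mean (PMF.uniformOfFintype α) f := by
  rw [mean_uniform, mean_uniform, Equiv.sum_comp e f]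

end Mean

/-! ### Pointwise comparison of laws -/

/-- Every point has at most `K` times the mass under `p` that it has under `p'`. -/
def RatioLE {α : Type} (K : ℝ≥0∞) (p p' : PMF α) : Prop := ∀ a, p a ≤ K * p' a

section Ratio

variable {α β : Type} {K L : ℝ≥0∞}

theorem RatioLE.refl (p : PMF α) : RatioLE 1 p p := fun a => (one_mul (p a)).ge

theorem RatioLE.trans {p p' p'' : PMF α} (h : RatioLE K p p') (h' : RatioLE L p' p'') :
    RatioLE (K * L) p p'' := fun a =>
  (h a).trans ((mul_le_mul_right (h' a) K).trans (mul_assoc _ _ _).ge)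

theorem RatioLE.mono {p p' : PMF α} (h : RatioLE K p p') (hKL : K ≤ L) : RatioLE L p p' :=
  fun a => (h a).trans (mul_le_mul_left hKL _)

theorem RatioLE.bind {p p' : PMF α} {f f' : α → PMF β} (h : RatioLE K p p')
    (h' : ∀ a, RatioLE L (f a) (f' a)) : RatioLE (K * L) (p.bind f) (p'.bind f') := by
  intro b
  rw [PMF.bind_apply, PMF.bind_apply, ← ENNReal.tsum_mul_left]
  refine ENNReal.tsum_le_tsum fun a => ?_
  calc p a * f a b ≤ (K * p' a) * (L * f' a b) := mul_le_mul' (h a) (h' a b)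
    _ = K * L * (p' a * f' a b) := by ring

theorem RatioLE.bind_right (p : PMF α) {f f' : α → PMF β} (h : ∀ a, RatioLE L (f a) (f' a)) :
    RatioLE L (p.bind f) (p.bind f') := by
  have := (RatioLE.refl p).bind h
  rwa [one_mul] at this

theorem RatioLE.bind_left {p p' : PMF α} (f : α → PMF β) (h : RatioLE K p p') :
    RatioLE K (p.bind f) (p'.bind f) := by
  have := h.bind fun a => RatioLE.refl (f a)
  rwa [mul_one] at this

theorem RatioLE.toMeasure [MeasurableSpace α] {p p' : PMF α} (h : RatioLE K p p') {s : Set α}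
    (hs : MeasurableSet s) : p.toMeasure s ≤ K * p'.toMeasure s := by
  rw [PMF.toMeasure_apply _ hs, PMF.toMeasure_apply _ hs, ← ENNReal.tsum_mul_left]
  refine ENNReal.tsum_le_tsum fun a => ?_
  by_cases ha : a ∈ s
  · simpa [ha] using h a
  · simp [ha]

end Ratio

/-! ### Independent choices -/

section Independent

variable {ι : Type} [Fintype ι] [DecidableEq ι] {β : ι → Type} [∀ i, Fintype (β i)]

theorem independent_apply (p : ∀ i, PMF (β i)) (f : ∀ i, β i) :
    independent p f = ∏ i, p i (f i) := rfl

theorem sum_independent_mul_prod (p : ∀ i, PMF (β i)) (h : ∀ i, β i → ℝ≥0∞) :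
    ∑ f, independent p f * ∏ i, h i (f i) = ∏ i, ∑ b, p i b * h i b := by
  rw [Finset.prod_univ_sum, Fintype.piFinset_univ]
  exact Finset.sum_congr rfl fun f _ => by rw [independent_apply, Finset.prod_mul_distrib]

theorem apply_ne_zero_of_independent {p : ∀ i, PMF (β i)} {f : ∀ i, β i}
    (h : independent p f ≠ 0) (i : ι) : p i (f i) ≠ 0 := by
  rw [independent_apply] at h
  exact fun h0 => h (Finset.prod_eq_zero (Finset.mem_univ i) h0)

/-- Independent choices are unchanged in law if one of them is drawn afresh. -/
theorem independent_update (p : ∀ i, PMF (β i)) (u : ι) (π : PMF (β u)) :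
    independent (Function.update p u π) =
      π.bind fun a => (independent p).map fun f => Function.update f u a := by
  classical
  ext f₀
  rw [PMF.bind_apply, tsum_eq_single (f₀ u)]
  -- The disjunct `i = u` leaves coordinate `u` free, so the product of indicators describes exactly
  -- those `f` that become `f₀` once `u` is overwritten, and the sum over this fibre factorizes.
  · have key := sum_independent_mul_prod p fun i b => if b = f₀ i ∨ i = u then 1 else 0
    have hL : ∀ f : ∀ i, β i, (independent p f * ∏ i, if f i = f₀ i ∨ i = u then (1 : ℝ≥0∞) else 0) =
        if f₀ = Function.update f u (f₀ u) then independent p f else 0 := by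
      intro f
      split_ifs with hf
      · rw [Finset.prod_eq_one, mul_one]
        intro i _
        by_cases hi : i = u
        · simp [hi]
        · have := congrFun hf i
          rw [Function.update_of_ne hi] at this
          simp [this]
      · rw [Finset.prod_ite_zero, if_neg, mul_zero]
        intro hall
        refine hf (funext fun i => ?_)
        by_cases hi : i = u
        · subst hi; simp
        · rw [Function.update_of_ne hi]
          exact ((hall i (Finset.mem_univ i)).resolve_right hi).symm
    have hmap : ((independent p).map fun f => Function.update f u (f₀ u)) f₀ =
        ∏ i, ∑ b, p i b * if b = f₀ i ∨ i = u then 1 else 0 := by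
      rw [PMF.map_apply, tsum_fintype, ← key]
      refine Finset.sum_congr rfl fun f _ => ?_
      rw [hL f]
      congr
    rw [hmap, independent_apply, ← Finset.mul_prod_erase _ _ (Finset.mem_univ u),
      ← Finset.mul_prod_erase (Finset.univ) (fun i => ∑ b, p i b * if b = f₀ i ∨ i = u then 1 else 0)
        (Finset.mem_univ u)]
    have hu : (∑ b, p u b * if b = f₀ u ∨ u = u then 1 else 0) = 1 := by
      simp only [or_true, if_true, mul_one]
      rw [← tsum_fintype (L := .unconditional _), (p u).tsum_coe]
    rw [hu, one_mul, Function.update_self]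
    congr 1
    refine Finset.prod_congr rfl fun i hi => ?_
    have hi' : i ≠ u := Finset.ne_of_mem_erase hi
    rw [Function.update_of_ne hi']
    simp [hi']
  · intro a ha
    have hzero : ((independent p).map fun f => Function.update f u a) f₀ = 0 := by
      rw [PMF.map_apply]
      refine ENNReal.tsum_eq_zero.2 fun f => if_neg fun h => ha ?_
      have := congrFun h u
      rw [Function.update_self] at this
      exact this.symm
    rw [hzero, mul_zero]

/-- A draw from the updated law is a draw from the old one with coordinate `u` overwritten. After
the overwriting is undone at cost `M`, the fresh value is no longer used and its law `π` integrates
out; `π` and `p u` need not be related. -/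
theorem RatioLE.independent_update_bind {γ : Type} {M : ℝ≥0∞} (p : ∀ i, PMF (β i)) (u : ι)
    (π : PMF (β u)) (g : (∀ i, β i) → PMF γ)
    (h : ∀ f a, RatioLE M (g (Function.update f u a)) (g f)) :
    RatioLE M ((independent (Function.update p u π)).bind g) ((independent p).bind g) := by
  rw [independent_update, PMF.bind_bind]
  have := RatioLE.bind_right (L := M) π (f := fun a => ((independent p).map
    fun f => Function.update f u a).bind g) (f' := fun _ => (independent p).bind g) fun a => by
      rw [PMF.bind_map]
      exact RatioLE.bind_right _ fun f => h f a
  rwa [PMF.bind_const] at this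

end Independent

/-! ### The exponential mechanism -/

section ExpMechanism

variable {C : Type} [Fintype C] [Nonempty C]

theorem sum_exp_pos (r : ℝ) (s : C → ℝ) : 0 < ∑ c, Real.exp (r * s c) :=
  Finset.sum_pos (fun _ _ => Real.exp_pos _) Finset.univ_nonempty

theorem expMechanism_apply (r : ℝ) (s : C → ℝ) (c : C) :
    expMechanism r s c =
      ENNReal.ofReal (Real.exp (r * s c) / ∑ c', Real.exp (r * s c')) := by
  rw [expMechanism, PMF.normalize_apply, tsum_fintype,
    ← ENNReal.ofReal_sum_of_nonneg fun _ _ => (Real.exp_pos _).le,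
    ← ENNReal.ofReal_inv_of_pos (sum_exp_pos r s), ← ENNReal.ofReal_mul (Real.exp_pos _).le,
    div_eq_mul_inv]

theorem toReal_expMechanism (r : ℝ) (s : C → ℝ) (c : C) :
    (expMechanism r s c).toReal = Real.exp (r * s c) / ∑ c', Real.exp (r * s c') := by
  rw [expMechanism_apply, ENNReal.toReal_ofReal (div_nonneg (Real.exp_pos _).le (sum_exp_pos r s).le)]

/-- Privacy of the exponential mechanism. -/
theorem ratioLE_expMechanism {r k : ℝ} (hr : 0 ≤ r) {s s' : C → ℝ}
    (h : ∀ c, |s c - s' c| ≤ k) :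
    RatioLE (ENNReal.ofReal (Real.exp (2 * r * k))) (expMechanism r s) (expMechanism r s') := by
  intro c
  rw [expMechanism_apply, expMechanism_apply, ← ENNReal.ofReal_mul (Real.exp_pos _).le]
  refine ENNReal.ofReal_le_ofReal ?_
  have h1 : Real.exp (r * s c) ≤ Real.exp (r * k) * Real.exp (r * s' c) := by
    rw [← Real.exp_add]
    refine Real.exp_le_exp.2 ?_
    nlinarith [abs_le.1 (h c)]
  have h2 : ∑ c', Real.exp (r * s' c') ≤ Real.exp (r * k) * ∑ c', Real.exp (r * s c') := by
    rw [Finset.mul_sum]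
    refine Finset.sum_le_sum fun c' _ => ?_
    rw [← Real.exp_add]
    refine Real.exp_le_exp.2 ?_
    nlinarith [abs_le.1 (h c')]
  have hZ := sum_exp_pos r s
  have hZ' := sum_exp_pos r s'
  rw [← mul_div_assoc, div_le_div_iff₀ hZ hZ']
  calc Real.exp (r * s c) * ∑ c', Real.exp (r * s' c')
      ≤ (Real.exp (r * k) * Real.exp (r * s' c)) *
          (Real.exp (r * k) * ∑ c', Real.exp (r * s c')) :=
        mul_le_mul h1 h2 hZ'.le (by positivity)
    _ = _ := by
      rw [show 2 * r * k = r * k + r * k by ring, Real.exp_add]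
      ring

/-- Utility of the exponential mechanism: if all points of `A` have score at least `M`, then the
expected score is at least `M - log (|C| / |A|) / r`. -/
theorem le_mean_expMechanism {r M : ℝ} (hr : 0 < r) (s : C → ℝ) (A : Finset C)
    (hA : A.Nonempty) (hM : ∀ c ∈ A, M ≤ s c) :
    M - Real.log ((Fintype.card C : ℝ) / A.card) / r ≤ mean (expMechanism r s) s := by
  set Z := ∑ c', Real.exp (r * s c') with hZdef
  have hZ : 0 < Z := sum_exp_pos r s
  set N : ℝ := (Fintype.card C : ℝ) with hN
  have hNpos : 0 < N := by rw [hN]; exact_mod_cast Fintype.card_pos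
  have hApos : (0 : ℝ) < A.card := by exact_mod_cast hA.card_pos
  have hlogZ : r * M + Real.log A.card ≤ Real.log Z := by
    rw [← Real.log_exp (r * M), ← Real.log_mul (Real.exp_pos _).ne' hApos.ne']
    refine Real.log_le_log (by positivity) ?_
    calc Real.exp (r * M) * A.card = ∑ _c ∈ A, Real.exp (r * M) := by
          rw [Finset.sum_const, nsmul_eq_mul, mul_comm]
      _ ≤ ∑ c ∈ A, Real.exp (r * s c) := Finset.sum_le_sum fun c hc =>
          Real.exp_le_exp.2 (mul_le_mul_of_nonneg_left (hM c hc) hr.le)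
      _ ≤ Z := Finset.sum_le_sum_of_subset_of_nonneg (Finset.subset_univ _)
          fun _ _ _ => (Real.exp_pos _).le
  set p : C → ℝ := fun c => Real.exp (r * s c) / Z with hp
  have hpsum : ∑ c, p c = 1 := by rw [hp, ← Finset.sum_div, ← hZdef, div_self hZ.ne']
  -- This is Gibbs' inequality before summation: `log y ≤ y - 1` at `y = 1 / (N * p c)`. Summed over
  -- `c` it says that the entropy of `p`, which is `log Z - r * E s`, is at most `log N`.
  have hterm : ∀ c, p c * (Real.log Z - Real.log N) - p c * (r * s c) ≤ 1 / N - p c := by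
    intro c
    have hpc : 0 < p c := div_pos (Real.exp_pos _) hZ
    have hlog : Real.log (1 / (N * p c)) = Real.log Z - Real.log N - r * s c := by
      rw [one_div, Real.log_inv, Real.log_mul hNpos.ne' hpc.ne', hp,
        Real.log_div (Real.exp_pos _).ne' hZ.ne', Real.log_exp]
      ring
    have hle := Real.log_le_sub_one_of_pos (show 0 < 1 / (N * p c) by positivity)
    rw [hlog] at hle
    have := mul_le_mul_of_nonneg_left hle hpc.le
    calc _ = p c * (Real.log Z - Real.log N - r * s c) := by ring
      _ ≤ _ := this
      _ = 1 / N - p c := by field_simp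
  have hsum := Finset.sum_le_sum fun c (_ : c ∈ Finset.univ) => hterm c
  rw [Finset.sum_sub_distrib, Finset.sum_sub_distrib, ← Finset.sum_mul, hpsum, Finset.sum_const,
    Finset.card_univ, nsmul_eq_mul, ← hN, mul_one_div_cancel hNpos.ne', one_mul, sub_self] at hsum
  have hmean : ∑ c, p c * (r * s c) = r * mean (expMechanism r s) s := by
    rw [mean_eq_sum, Finset.mul_sum]
    refine Finset.sum_congr rfl fun c _ => ?_
    rw [toReal_expMechanism, hp]
    ring
  rw [hmean] at hsum
  rw [Real.log_div hNpos.ne' hApos.ne', sub_le_iff_le_add, ← sub_le_iff_le_add', le_div_iff₀ hr]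
  nlinarith

/-- Chebyshev's sum inequality: the weights increase with the score. -/
theorem mean_uniform_le_mean_expMechanism {r : ℝ} (hr : 0 ≤ r) (s : C → ℝ) :
    mean (PMF.uniformOfFintype C) s ≤ mean (expMechanism r s) s := by
  have hZ := sum_exp_pos r s
  rw [mean_uniform, mean_eq_sum, div_le_iff₀ (by exact_mod_cast Fintype.card_pos)]
  have hmono : Monovary (fun c => (expMechanism r s c).toReal) s := by
    intro c c' hcc
    simp only [toReal_expMechanism]
    have := mul_le_mul_of_nonneg_left hcc.le hr
    gcongr
  have := hmono.sum_smul_sum_le_card_smul_sum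
  rw [sum_toReal, one_smul] at this
  simpa [mul_comm] using this

/-- Comparison of an event with its image under a bijection that lowers the score by a fixed
amount on the event. -/
theorem mean_expMechanism_of_equiv (r k : ℝ) (s : C → ℝ) (τ : C ≃ C) (A : C → Prop)
    [DecidablePred A] (hA : ∀ c, A (τ c) ↔ ¬ A c) (hs : ∀ c, A c → s c = s (τ c) + k) :
    mean (expMechanism r s) (fun c => if A c then 1 else 0) =
      Real.exp (r * k) / (1 + Real.exp (r * k)) := by
  set P := mean (expMechanism r s) (fun c => if A c then 1 else 0) with hP
  have hnot : mean (expMechanism r s) (fun c => if A c then 0 else 1) = 1 - P := by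
    have h1 := mean_const (expMechanism r s) 1
    rw [hP, ← h1, ← mean_sub]
    refine mean_congr _ fun c _ => ?_
    rw [h1]
    split_ifs <;> norm_num
  -- Reindexing the mass of the complement by `τ` matches it with the event, point by point, at
  -- ratio `exp (r * k)`.
  have hrel : P = Real.exp (r * k) * (1 - P) := by
    rw [← hnot, hP, mean_eq_sum, mean_eq_sum, ← Equiv.sum_comp τ
      (fun c => (expMechanism r s c).toReal * if A c then 0 else 1), Finset.mul_sum]
    refine Finset.sum_congr rfl fun c _ => ?_
    by_cases hc : A c
    · have : ¬ A (τ c) := fun h => (hA c).1 h hc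
      rw [if_pos hc, if_neg this, toReal_expMechanism, toReal_expMechanism, hs c hc, mul_add,
        Real.exp_add]
      ring
    · rw [if_neg hc, if_pos ((hA c).2 hc)]
      ring
  rw [eq_div_iff (by positivity)]
  linarith

end ExpMechanism

/-! ### Edges and cuts -/

section Edges

variable {V : Type}

/-- The endpoints of the edge `e` lie on different sides of `x`. -/
def IsSplit (x : Cut V) (e : Sym2 V) : Prop := ¬ (e.map x).IsDiag

instance (x : Cut V) : DecidablePred (IsSplit x) := fun e => by unfold IsSplit; infer_instance

@[simp] theorem isSplit_mk (x : Cut V) (u v : V) : IsSplit x s(u, v) ↔ x u ≠ x v := by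
  simp [IsSplit]

/-- The edges of `G` as a finite set. -/
def edges [Finite V] (G : SimpleGraph V) : Finset (Sym2 V) := (Set.toFinite G.edgeSet).toFinset

@[simp] theorem mem_edges [Finite V] {G : SimpleGraph V} {e : Sym2 V} :
    e ∈ edges G ↔ e ∈ G.edgeSet := by simp [edges]

theorem edgeCount_eq_card [Finite V] (G : SimpleGraph V) : edgeCount G = (edges G).card :=
  Set.ncard_eq_toFinset_card _ _

theorem cutValue_eq_card [Finite V] (G : SimpleGraph V) (x : Cut V) :
    cutValue G x = ((edges G).filter (IsSplit x)).card := by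
  rw [cutValue, ← Set.ncard_coe_finset]
  congr 1
  ext e
  induction e using Sym2.ind with
  | _ u v =>
    simp only [Set.mem_ofPred_eq, Finset.coe_filter, mem_edges, SimpleGraph.mem_edgeSet, isSplit_mk]
    constructor
    · rintro ⟨a, b, hab, h, hne⟩
      rcases Sym2.eq_iff.1 hab with ⟨rfl, rfl⟩ | ⟨rfl, rfl⟩
      · exact ⟨h, hne⟩
      · exact ⟨h.symm, hne.symm⟩
    · exact fun h => ⟨u, v, rfl, h⟩

theorem cutValue_le_add_card [Finite V] {G G' : SimpleGraph V} (T : Finset (Sym2 V))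
    (h : ∀ e ∈ G.edgeSet, e ∉ T → e ∈ G'.edgeSet) (x : Cut V) :
    cutValue G x ≤ cutValue G' x + T.card := by
  classical
  rw [cutValue_eq_card, cutValue_eq_card]
  refine (Finset.card_le_card fun e he => ?_).trans (Finset.card_union_le _ _)
  rw [Finset.mem_filter, mem_edges] at he
  rw [Finset.mem_union, Finset.mem_filter, mem_edges]
  by_cases heT : e ∈ T
  · exact Or.inr heT
  · exact Or.inl ⟨h e he.1 heT, he.2⟩

theorem abs_cutValue_sub_le [Finite V] {G G' : SimpleGraph V} (T : Finset (Sym2 V)) {k : ℝ}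
    (hk : (T.card : ℝ) ≤ k) (h : ∀ e ∉ T, (e ∈ G.edgeSet ↔ e ∈ G'.edgeSet)) (x : Cut V) :
    |(cutValue G x : ℝ) - cutValue G' x| ≤ k := by
  have h1 : (cutValue G x : ℝ) ≤ cutValue G' x + T.card := by
    exact_mod_cast cutValue_le_add_card T (fun e he heT => (h e heT).1 he) x
  have h2 : (cutValue G' x : ℝ) ≤ cutValue G x + T.card := by
    exact_mod_cast cutValue_le_add_card T (fun e he heT => (h e heT).2 he) x
  rw [abs_le]
  constructor <;> linarith

/-- The two graphs agree on all pairs other than `e₀`. -/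
def AgreeOff (e₀ : Sym2 V) (G G' : SimpleGraph V) : Prop :=
  ∀ e, e ≠ e₀ → (e ∈ G.edgeSet ↔ e ∈ G'.edgeSet)

theorem AgreeOff.symm {e₀ : Sym2 V} {G G' : SimpleGraph V} (h : AgreeOff e₀ G G') :
    AgreeOff e₀ G' G := fun e he => (h e he).symm

theorem AgreeOff.abs_cutValue_sub_le [Finite V] {e₀ : Sym2 V} {G G' : SimpleGraph V}
    (h : AgreeOff e₀ G G') (x : Cut V) : |(cutValue G x : ℝ) - cutValue G' x| ≤ 1 :=
  PrivateMaxCut.abs_cutValue_sub_le {e₀} (by simp) (fun e he => h e (by simpa using he)) x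

theorem AgreeOff.adj_iff {u v : V} {G G' : SimpleGraph V} (h : AgreeOff s(u, v) G G') {a b : V}
    (hu : a ≠ u) (hv : a ≠ v) : G.Adj a b ↔ G'.Adj a b := by
  rw [← SimpleGraph.mem_edgeSet, ← SimpleGraph.mem_edgeSet]
  refine h _ fun hab => ?_
  rcases Sym2.eq_iff.1 hab with ⟨rfl, rfl⟩ | ⟨rfl, rfl⟩
  · exact hu rfl
  · exact hv rfl

end Edges

/-! ### Privacy of the random matching -/

section MatchingPrivacy

variable {W : Type} [Fintype W] [DecidableEq W]

omit [DecidableEq W] in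
theorem chooseNeighbor_congr {G G' : SimpleGraph W} {v : W}
    (h : ∀ w, G.Adj v w ↔ G'.Adj v w) : chooseNeighbor G v = chooseNeighbor G' v := by
  classical
  have key : G.neighborFinset v = G'.neighborFinset v := by
    ext w
    simp [h w]
  unfold chooseNeighbor
  by_cases h0 : (G.neighborFinset v).Nonempty
  · have h0' : (G'.neighborFinset v).Nonempty := key ▸ h0
    rw [dif_pos (by convert h0), dif_pos (by convert h0')]
    congr 2
  · have h0' : ¬ (G'.neighborFinset v).Nonempty := key ▸ h0
    rw [dif_neg (by convert h0), dif_neg (by convert h0')]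

omit [Fintype W] in
theorem mem_edgeSet_mutualChoices_of_update (G : SimpleGraph W) (f : W → Option W) (u : W)
    (a : Option W) {e : Sym2 W} (he : e ∈ (mutualChoices G f).edgeSet)
    (h : ∀ w, f u = some w → e ≠ s(u, w)) :
    e ∈ (mutualChoices G (Function.update f u a)).edgeSet := by
  induction e using Sym2.ind with
  | _ x y =>
    obtain ⟨hadj, hx, hy⟩ := he
    refine ⟨hadj, ?_, ?_⟩
    · rw [Function.update_of_ne, hx]
      rintro rfl
      exact h y hx rfl
    · rw [Function.update_of_ne, hy]
      rintro rfl
      exact h x hy Sym2.eq_swap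

/-- A new choice at `u` can only destroy the edge to the old choice and create the edge to the new
one. -/
theorem abs_cutValue_mutualChoices_update_sub_le (G : SimpleGraph W) (f : W → Option W) (u : W)
    (a : Option W) (x : Cut W) :
    |(cutValue (mutualChoices G (Function.update f u a)) x : ℝ) -
      cutValue (mutualChoices G f) x| ≤ 2 := by
  refine abs_cutValue_sub_le
    (((f u).toFinset.image fun w => s(u, w)) ∪ (a.toFinset.image fun w => s(u, w))) ?_ ?_ x
  · have hc : ∀ o : Option W, (o.toFinset.image fun w => s(u, w)).card ≤ 1 := fun o =>
      Finset.card_image_le.trans (by cases o <;> simp)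
    exact_mod_cast (Finset.card_union_le _ _).trans (Nat.add_le_add (hc _) (hc _))
  · intro e he
    simp only [Finset.mem_union, Finset.mem_image, Option.mem_toFinset, Option.mem_def, not_or,
      not_exists, not_and] at he
    constructor
    · intro h
      have := mem_edgeSet_mutualChoices_of_update G (Function.update f u a) u (f u) h
        fun w hw => by
          rw [Function.update_self] at hw
          exact fun h' => he.2 w hw h'.symm
      rwa [Function.update_idem, Function.update_eq_self] at this
    · intro h
      exact mem_edgeSet_mutualChoices_of_update G f u a h fun w hw h' => he.1 w hw h'.symm

/-- The law of the cut drawn by the exponential mechanism on the mutual choices in `G`. -/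
def mutualChoiceCut (r : ℝ) (G : SimpleGraph W) : PMF (Cut W) :=
  (independent fun v => chooseNeighbor G v).bind fun f =>
    expMechanism r fun x : Cut W => (cutValue (mutualChoices G f) x : ℝ)

/-- The changed pair affects the law in three places: as a possible edge of the matching
(sensitivity 1, cost `2r`), and in the choices of its two endpoints (sensitivity 2, cost `4r` each).
All other vertices see the same neighbours, which gives `10r` in total. -/
theorem ratioLE_mutualChoiceCut {r : ℝ} (hr : 0 ≤ r) {e₀ : Sym2 W} {G G' : SimpleGraph W}
    (h : AgreeOff e₀ G G') :
    RatioLE (ENNReal.ofReal (Real.exp (10 * r))) (mutualChoiceCut r G) (mutualChoiceCut r G') := by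
  induction e₀ using Sym2.ind with
  | _ u v =>
    have h1 : RatioLE (ENNReal.ofReal (Real.exp (2 * r * 1))) (mutualChoiceCut r G)
        ((independent fun v => chooseNeighbor G v).bind fun f =>
          expMechanism r fun x : Cut W => (cutValue (mutualChoices G' f) x : ℝ)) := by
      refine RatioLE.bind_right _ fun f => ratioLE_expMechanism hr fun x => ?_
      refine AgreeOff.abs_cutValue_sub_le (e₀ := s(u, v)) (fun e he => ?_) x
      induction e using Sym2.ind with
      | _ a b => exact and_congr_left fun _ => h _ he
    have h2 : ∀ (p : W → PMF (Option W)) (w : W) (π : PMF (Option W)),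
        RatioLE (ENNReal.ofReal (Real.exp (2 * r * 2)))
          ((independent (Function.update p w π)).bind fun f =>
            expMechanism r fun x : Cut W => (cutValue (mutualChoices G' f) x : ℝ))
          ((independent p).bind fun f =>
            expMechanism r fun x : Cut W => (cutValue (mutualChoices G' f) x : ℝ)) :=
      fun p w π => RatioLE.independent_update_bind p w π _ fun f a =>
        ratioLE_expMechanism hr fun x => abs_cutValue_mutualChoices_update_sub_le G' f w a x
    have hG : (fun w => chooseNeighbor G w) = Function.update (Function.update
        (fun w => chooseNeighbor G' w) u (chooseNeighbor G u)) v (chooseNeighbor G v) := by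
      funext w
      by_cases hv : w = v
      · subst hv; simp
      rw [Function.update_of_ne hv]
      by_cases hu : w = u
      · subst hu; simp
      rw [Function.update_of_ne hu]
      exact chooseNeighbor_congr fun b => h.adj_iff hu hv
    rw [hG] at h1
    refine (h1.trans ((h2 _ _ _).trans (h2 _ _ _))).mono (le_of_eq ?_)
    rw [← ENNReal.ofReal_mul (Real.exp_pos _).le, ← ENNReal.ofReal_mul (Real.exp_pos _).le,
      ← Real.exp_add, ← Real.exp_add]
    congr 2
    ring

/-- The subgraph of `G` whose edges are marked `true`. -/
def keptGraph (G : SimpleGraph W) (keep : Sym2 W → Bool) : SimpleGraph W :=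
  SimpleGraph.fromEdgeSet {e | e ∈ G.edgeSet ∧ keep e = true}

omit [Fintype W] [DecidableEq W] in
theorem mem_edgeSet_keptGraph {G : SimpleGraph W} {keep : Sym2 W → Bool} {e : Sym2 W} :
    e ∈ (keptGraph G keep).edgeSet ↔ e ∈ G.edgeSet ∧ keep e = true := by
  rw [keptGraph, SimpleGraph.edgeSet_fromEdgeSet]
  simp only [Set.mem_sdiff, Set.mem_ofPred_eq, and_iff_left_iff_imp]
  exact fun h => SimpleGraph.not_isDiag_of_mem_edgeSet G h.1

theorem subsample_eq (q : ℝ) (G : SimpleGraph W) :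
    subsample q G = (independent fun _ : Sym2 W => coin q).map (keptGraph G) := rfl

theorem randomMatching_eq (q : ℝ) (G : SimpleGraph W) :
    randomMatching q G = (subsample q G).bind fun G₂ =>
      (independent fun v => chooseNeighbor G₂ v).map (mutualChoices G₂) := rfl

theorem coin_true {q : ℝ} (hq : q ≤ 1) : coin q true = ENNReal.ofReal q := by
  rw [coin, PMF.ofFintype_apply]
  simp [hq]

theorem coin_false {q : ℝ} (h0 : 0 ≤ q) (hq : q ≤ 1) : coin q false = ENNReal.ofReal (1 - q) := by
  rw [coin, PMF.ofFintype_apply, ENNReal.ofReal_sub _ h0]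
  simp [hq]

/-- The law of the cut drawn by the exponential mechanism on the random matching. -/
def matchingCut (q r : ℝ) (G : SimpleGraph W) : PMF (Cut W) :=
  (randomMatching q G).bind fun GM => expMechanism r fun x : Cut W => (cutValue GM x : ℝ)

/-- Isolates the coin of `e₀`: redrawing a coordinate from its own law changes nothing. -/
theorem matchingCut_eq_bind (q r : ℝ) (G : SimpleGraph W) (e₀ : Sym2 W) :
    matchingCut q r G = (coin q).bind fun b => (independent fun _ : Sym2 W => coin q).bind
      fun keep => mutualChoiceCut r (keptGraph G (Function.update keep e₀ b)) := by
  have h : (independent fun _ : Sym2 W => coin q) = (coin q).bind fun b =>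
      (independent fun _ : Sym2 W => coin q).map fun keep => Function.update keep e₀ b := by
    rw [← independent_update (fun _ : Sym2 W => coin q) e₀ (coin q)]
    exact congrArg independent (Function.update_eq_self e₀ fun _ : Sym2 W => coin q).symm
  have h' : matchingCut q r G = (independent fun _ : Sym2 W => coin q).bind
      fun keep => mutualChoiceCut r (keptGraph G keep) := by
    rw [matchingCut, randomMatching_eq, subsample_eq, PMF.bind_bind, PMF.bind_map]
    congr 1
    funext keep
    simp only [Function.comp_apply, PMF.bind_map, mutualChoiceCut]
    rfl
  rw [h']
  conv_lhs => rw [h]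
  rw [PMF.bind_bind]
  simp only [PMF.bind_map]
  rfl

/-- Amplification by subsampling for the cut of the random matching. -/
theorem ratioLE_matchingCut {q r K : ℝ} (h0 : 0 ≤ q) (hq : q ≤ 1) (hr : 0 ≤ r)
    (hK : 1 - q + q * Real.exp (10 * r) ≤ K * (1 - q)) (hK0 : 0 ≤ K) {e₀ : Sym2 W}
    {G G' : SimpleGraph W} (h : AgreeOff e₀ G G') :
    RatioLE (ENNReal.ofReal K) (matchingCut q r G) (matchingCut q r G') := by
  set B : SimpleGraph W → Bool → PMF (Cut W) := fun G b =>
    (independent fun _ : Sym2 W => coin q).bind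
      fun keep => mutualChoiceCut r (keptGraph G (Function.update keep e₀ b)) with hB
  have hkept : ∀ keep, keptGraph G (Function.update keep e₀ false) =
      keptGraph G' (Function.update keep e₀ false) := by
    intro keep
    rw [← SimpleGraph.edgeSet_inj]
    ext e
    rw [mem_edgeSet_keptGraph, mem_edgeSet_keptGraph]
    by_cases he : e = e₀
    · simp [he]
    · rw [h e he]
  have hfalse : B G false = B G' false := by simp only [hB, hkept]
  -- The comparison is with `G'` when `e₀` is dropped, not when it is kept. Then all of `matchingCut
  -- q r G` is bounded by a multiple of the dropped part of `G'`, whose weight is `1 - q`; the kept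
  -- part of `G'` is discarded at the end.
  have htrue : RatioLE (ENNReal.ofReal (Real.exp (10 * r))) (B G true) (B G' false) := by
    refine RatioLE.bind_right _ fun keep => ratioLE_mutualChoiceCut hr (e₀ := e₀) fun e he => ?_
    rw [mem_edgeSet_keptGraph, mem_edgeSet_keptGraph, Function.update_of_ne he,
      Function.update_of_ne he, h e he]
  intro x
  have hexp : ∀ G : SimpleGraph W, matchingCut q r G x =
      ENNReal.ofReal q * B G true x + ENNReal.ofReal (1 - q) * B G false x := by
    intro G
    rw [matchingCut_eq_bind q r G e₀, PMF.bind_apply, tsum_fintype, Fintype.sum_bool, coin_true hq,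
      coin_false h0 hq]
  have h1q : 0 ≤ 1 - q := sub_nonneg.2 hq
  rw [hexp G, hexp G', hfalse]
  calc ENNReal.ofReal q * B G true x + ENNReal.ofReal (1 - q) * B G' false x
      ≤ ENNReal.ofReal q * (ENNReal.ofReal (Real.exp (10 * r)) * B G' false x) +
          ENNReal.ofReal (1 - q) * B G' false x := by
        gcongr
        exact htrue x
    _ = ENNReal.ofReal (1 - q + q * Real.exp (10 * r)) * B G' false x := by
        rw [ENNReal.ofReal_add h1q (by positivity), ENNReal.ofReal_mul h0]
        ring
    _ ≤ ENNReal.ofReal (K * (1 - q)) * B G' false x := by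
        gcongr
    _ = ENNReal.ofReal K * (ENNReal.ofReal (1 - q) * B G' false x) := by
        rw [ENNReal.ofReal_mul hK0, mul_assoc]
    _ ≤ _ := by
        gcongr
        exact le_add_self

end MatchingPrivacy

/-! ### The two random cuts and the selection -/

section Structure

variable {V : Type} [Fintype V] [DecidableEq V]

/-- The law of the cut `S₁`: exponential mechanism on `V₁`, uniform on the complement. -/
def highCut (ε : ℝ) (G : SimpleGraph V) (V₁ : Finset V) : PMF (Cut V) :=
  (expMechanism (ε / 12) fun x : Cut {v // v ∈ V₁} =>
    (cutValue (inducedOn G (· ∈ V₁)) x : ℝ)).bind fun a =>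
      (PMF.uniformOfFintype (Cut {v // v ∉ V₁})).map fun b => concatCut V₁ a b

/-- The law of the cut `S₂`: random matching outside of `V₁`, uniform on `V₁`. -/
def lowCut (α ε : ℝ) (G : SimpleGraph V) (V₁ : Finset V) : PMF (Cut V) :=
  (matchingCut (ε ^ (1 + α) / 70) (2.5 / 4) (inducedOn G (· ∉ V₁))).bind fun a =>
    (PMF.uniformOfFintype (Cut {v // v ∈ V₁})).map fun b => concatCut V₁ b a

/-- The private choice among two cuts and the cut between `V₁` and its complement. -/
def selectCut (ε : ℝ) (G : SimpleGraph V) (V₁ : Finset V) (x₁ x₂ : Cut V) : PMF (Cut V) :=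
  (expMechanism (ε / 2 / 2) fun i =>
    (cutValue G ((![x₁, x₂, fun v => decide (v ∈ V₁)] : Fin 3 → Cut V) i) : ℝ)).map
      (![x₁, x₂, fun v => decide (v ∈ V₁)] : Fin 3 → Cut V)

theorem cutOfPartition_eq (α ε : ℝ) (G : SimpleGraph V) (V₁ : Finset V) :
    cutOfPartition α ε G V₁ = (highCut ε G V₁).bind fun x₁ =>
      (lowCut α ε G V₁).bind fun x₂ => selectCut ε G V₁ x₁ x₂ := by
  simp only [highCut, lowCut, matchingCut, PMF.bind_bind, PMF.bind_map]
  rfl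

end Structure

/-! ### Privacy of the stages after the partition -/

section CutPrivacy

variable {V : Type}

theorem inducedOn_agreeOff {u v : V} {G G' : SimpleGraph V} (h : AgreeOff s(u, v) G G')
    (P : V → Prop) (hu : P u) (hv : P v) :
    AgreeOff s((⟨u, hu⟩ : {v // P v}), ⟨v, hv⟩) (inducedOn G P) (inducedOn G' P) := by
  intro e he
  induction e using Sym2.ind with
  | _ a b =>
    refine h s(a.1, b.1) fun hab => he ?_
    refine Sym2.map.injective Subtype.val_injective ?_
    simpa using hab

theorem inducedOn_eq {u v : V} {G G' : SimpleGraph V} (h : AgreeOff s(u, v) G G')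
    (P : V → Prop) (hP : ¬ (P u ∧ P v)) : inducedOn G P = inducedOn G' P := by
  ext a b
  refine h s(a.1, b.1) fun hab => hP ?_
  rcases Sym2.eq_iff.1 hab with ⟨rfl, rfl⟩ | ⟨rfl, rfl⟩
  · exact ⟨a.2, b.2⟩
  · exact ⟨b.2, a.2⟩

variable [Fintype V] [DecidableEq V]

theorem ratioLE_selectCut {ε : ℝ} (hε : 0 ≤ ε) {e₀ : Sym2 V} {G G' : SimpleGraph V}
    (h : AgreeOff e₀ G G') (V₁ : Finset V) (x₁ x₂ : Cut V) :
    RatioLE (ENNReal.ofReal (Real.exp (ε / 2))) (selectCut ε G V₁ x₁ x₂)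
      (selectCut ε G' V₁ x₁ x₂) := by
  have := ratioLE_expMechanism (r := ε / 2 / 2) (k := 1) (by positivity)
    (s := fun i => (cutValue G ((![x₁, x₂, fun v => decide (v ∈ V₁)] : Fin 3 → Cut V) i) : ℝ))
    (s' := fun i => (cutValue G' ((![x₁, x₂, fun v => decide (v ∈ V₁)] : Fin 3 → Cut V) i) : ℝ))
    fun i => h.abs_cutValue_sub_le _
  rw [show 2 * (ε / 2 / 2) * 1 = ε / 2 by ring] at this
  exact this.bind_left _

/-- With `V₁` fixed, the edge is inside `V₂`, inside `V₁`, or crossing. So at most one of the two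
random cuts depends on it, and `ε/3` is charged once; adding `ε/2` for the selection gives `5ε/6`.
-/
theorem ratioLE_cutOfPartition {α ε : ℝ} (hε : 0 ≤ ε)
    (h1 : ε ^ (1 + α) ≤ 0.0106 * ε) (hε1 : ε ≤ 0.1) {e₀ : Sym2 V} {G G' : SimpleGraph V}
    (h : AgreeOff e₀ G G') (V₁ : Finset V) :
    RatioLE (ENNReal.ofReal (Real.exp (5 * ε / 6))) (cutOfPartition α ε G V₁)
      (cutOfPartition α ε G' V₁) := by
  induction e₀ using Sym2.ind with
  | _ u v =>
    rw [cutOfPartition_eq, cutOfPartition_eq]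
    have hsel := ratioLE_selectCut hε h V₁
    have hexp : ENNReal.ofReal (Real.exp (ε / 3)) * ENNReal.ofReal (Real.exp (ε / 2)) =
        ENNReal.ofReal (Real.exp (5 * ε / 6)) := by
      rw [← ENNReal.ofReal_mul (Real.exp_pos _).le, ← Real.exp_add]
      congr 2
      ring
    rw [← hexp]
    by_cases hlow : u ∉ V₁ ∧ v ∉ V₁
    · have hhigh : highCut ε G V₁ = highCut ε G' V₁ := by
        rw [highCut, highCut, inducedOn_eq h (· ∈ V₁) fun hh => hlow.1 hh.1]
      rw [hhigh]
      refine RatioLE.bind_right _ fun x₁ => RatioLE.bind ?_ fun x₂ => hsel x₁ x₂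
      refine RatioLE.bind_left _ (ratioLE_matchingCut (by positivity) (by linarith)
        (by norm_num) ?_ (Real.exp_pos _).le (inducedOn_agreeOff h (· ∉ V₁) hlow.1 hlow.2))
      -- A generous bound is enough: `1100 * 0.0106 / 70 < 1/6`, while the budget `ε/3` leaves room
      -- for nearly `ε/3`.
      have he : Real.exp (10 * (2.5 / 4)) ≤ 1100 := by
        calc Real.exp (10 * (2.5 / 4)) ≤ Real.exp 7 := Real.exp_le_exp.2 (by norm_num)
          _ = Real.exp 1 ^ 7 := by rw [← Real.exp_nat_mul]; norm_num
          _ ≤ 2.7182818286 ^ 7 := by gcongr; exact Real.exp_one_lt_d9.le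
          _ ≤ 1100 := by norm_num
      have hK := Real.add_one_le_exp (ε / 3)
      have hq0 : 0 ≤ ε ^ (1 + α) / 70 := by positivity
      have hq1 : ε ^ (1 + α) / 70 ≤ 0.0106 / 70 * ε := by linarith
      generalize ε ^ (1 + α) / 70 = q at hq0 hq1
      have h3 : q * Real.exp (10 * (2.5 / 4)) ≤ q * 1100 := by gcongr
      have h4 : (ε / 3 + 1) * (1 - q) ≤ Real.exp (ε / 3) * (1 - q) :=
        mul_le_mul_of_nonneg_right hK (by linarith)
      nlinarith
    · have hlowCut : lowCut α ε G V₁ = lowCut α ε G' V₁ := by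
        rw [lowCut, lowCut, inducedOn_eq h (· ∉ V₁) hlow]
      rw [hlowCut]
      refine RatioLE.bind ?_ fun x₁ => RatioLE.bind_right _ fun x₂ => hsel x₁ x₂
      by_cases hhigh : u ∈ V₁ ∧ v ∈ V₁
      · refine RatioLE.bind_left _ ((ratioLE_expMechanism (by positivity) fun x =>
          (inducedOn_agreeOff h (· ∈ V₁) hhigh.1 hhigh.2).abs_cutValue_sub_le x).mono ?_)
        exact ENNReal.ofReal_le_ofReal (Real.exp_le_exp.2 (by linarith))
      · rw [highCut, highCut, inducedOn_eq h (· ∈ V₁) hhigh]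
        refine (RatioLE.refl _).mono ?_
        rw [ENNReal.one_le_ofReal]
        exact Real.one_le_exp (by positivity)

end CutPrivacy

/-! ### Laplace noise -/

section Laplace

theorem laplace_apply (b : ℝ) {s : Set ℝ} (hs : MeasurableSet s) :
    laplace b s = ∫⁻ x in s, ENNReal.ofReal (1 / (2 * b) * Real.exp (-|x| / b)) :=
  withDensity_apply _ hs

theorem laplace_translate_le {b : ℝ} (hb : 0 < b) (c : ℝ) {s : Set ℝ} (hs : MeasurableSet s) :
    laplace b ((fun x => x + c) ⁻¹' s) ≤ ENNReal.ofReal (Real.exp (|c| / b)) * laplace b s := by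
  have hs' : MeasurableSet ((fun x => x + c) ⁻¹' s) := (measurable_add_const c) hs
  rw [laplace_apply b hs', laplace_apply b hs, ← lintegral_indicator hs', ← lintegral_indicator hs,
    ← lintegral_add_right_eq_self (s.indicator _) c, ← lintegral_const_mul' _ _ ENNReal.ofReal_ne_top]
  refine lintegral_mono fun x => ?_
  by_cases hx : x + c ∈ s
  · rw [Set.indicator_of_mem (show x ∈ (fun x => x + c) ⁻¹' s from hx), Set.indicator_of_mem hx,
      ← ENNReal.ofReal_mul (Real.exp_pos _).le]
    refine ENNReal.ofReal_le_ofReal ?_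
    have : Real.exp (-|x| / b) ≤ Real.exp (|c| / b) * Real.exp (-|x + c| / b) := by
      rw [← Real.exp_add, ← add_div]
      refine Real.exp_le_exp.2 (div_le_div_of_nonneg_right ?_ hb.le)
      linarith [abs_add_le x c]
    calc 1 / (2 * b) * Real.exp (-|x| / b)
        ≤ 1 / (2 * b) * (Real.exp (|c| / b) * Real.exp (-|x + c| / b)) := by gcongr
      _ = _ := by ring
  · rw [Set.indicator_of_notMem (show x ∉ (fun x => x + c) ⁻¹' s from hx)]
    exact zero_le

theorem laplace_Ioi {b : ℝ} (hb : 0 < b) {a : ℝ} (ha : 0 ≤ a) :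
    laplace b (Set.Ioi a) = ENNReal.ofReal (1 / 2 * Real.exp (-a / b)) := by
  rw [laplace_apply b measurableSet_Ioi]
  have h1 : ∫⁻ x in Set.Ioi a, ENNReal.ofReal (1 / (2 * b) * Real.exp (-|x| / b)) =
      ∫⁻ x in Set.Ioi a, ENNReal.ofReal (1 / (2 * b) * Real.exp (-b⁻¹ * x)) := by
    refine setLIntegral_congr_fun measurableSet_Ioi fun x hx => ?_
    have : 0 ≤ x := ha.trans (le_of_lt hx)
    simp only [abs_of_nonneg this]
    congr 3
    ring
  have hneg : -b⁻¹ < 0 := by simpa using hb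
  rw [h1, ← ofReal_integral_eq_lintegral_ofReal
    ((integrableOn_exp_mul_Ioi hneg a).const_mul _)
    (Filter.Eventually.of_forall fun x => by positivity), integral_const_mul,
    integral_exp_mul_Ioi hneg]
  congr 1
  rw [show -b⁻¹ * a = -a / b by ring]
  field_simp

theorem laplace_neg (b : ℝ) {s : Set ℝ} (hs : MeasurableSet s) :
    laplace b (Neg.neg ⁻¹' s) = laplace b s := by
  have hs' : MeasurableSet (Neg.neg ⁻¹' s : Set ℝ) := measurable_neg hs
  rw [laplace_apply b hs', laplace_apply b hs, ← lintegral_indicator hs', ← lintegral_indicator hs,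
    ← (Measure.measurePreserving_neg (volume : Measure ℝ)).lintegral_comp_emb
      (MeasurableEquiv.neg ℝ).measurableEmbedding]
  refine lintegral_congr fun x => ?_
  have hiff : -x ∈ (Neg.neg ⁻¹' s : Set ℝ) ↔ x ∈ s := by simp
  by_cases hx : x ∈ s
  · rw [Set.indicator_of_mem (hiff.2 hx), Set.indicator_of_mem hx, abs_neg]
  · rw [Set.indicator_of_notMem (mt hiff.1 hx), Set.indicator_of_notMem hx]

theorem laplace_Iio {b : ℝ} (hb : 0 < b) {a : ℝ} (ha : 0 ≤ a) :
    laplace b (Set.Iio (-a)) = ENNReal.ofReal (1 / 2 * Real.exp (-a / b)) := by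
  rw [← laplace_Ioi hb ha, ← laplace_neg b measurableSet_Ioi]
  congr 1
  ext x
  simp

theorem laplace_singleton (b a : ℝ) : laplace b {a} = 0 := by
  rw [laplace_apply b (measurableSet_singleton a)]
  simp

theorem laplace_Iic {b : ℝ} (hb : 0 < b) {a : ℝ} (ha : 0 ≤ a) :
    laplace b (Set.Iic (-a)) = ENNReal.ofReal (1 / 2 * Real.exp (-a / b)) := by
  rw [← Set.Iio_union_right, measure_union _ (measurableSet_singleton _), laplace_singleton,
    add_zero, laplace_Iio hb ha]
  simp

theorem isProbabilityMeasure_laplace {b : ℝ} (hb : 0 < b) : IsProbabilityMeasure (laplace b) := by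
  constructor
  rw [← Set.Iic_union_Ioi (a := (0 : ℝ)), measure_union (by simp) measurableSet_Ioi,
    laplace_Ioi hb le_rfl]
  have := laplace_Iic hb (le_refl (0 : ℝ))
  rw [neg_zero] at this
  rw [this, ← ENNReal.ofReal_add (by positivity) (by positivity)]
  norm_num

end Laplace

/-! ### The law of the partition -/

section Partition

variable {V : Type} [Fintype V]

/-- The values of the noise at a vertex of degree `d` for which the vertex is put on the side
`high` of the partition with threshold `t`. -/
def noiseSet (t : ℝ) (d : ℕ) (high : Prop) : Set ℝ := {z | t < (d : ℝ) + z ↔ high}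

theorem measurableSet_noiseSet (t : ℝ) (d : ℕ) (high : Prop) :
    MeasurableSet (noiseSet t d high) := by
  have h : MeasurableSet {z : ℝ | t < (d : ℝ) + z} :=
    measurableSet_lt measurable_const (by fun_prop)
  by_cases hh : high
  · simpa [noiseSet, hh] using h
  · simpa [noiseSet, hh, Set.compl_ofPred] using h.compl

/-- Membership of `v` depends on `z v` alone, so the event is a box. This gives both measurability
and the product formula for its probability. -/
theorem setOf_highDegree_eq (α ε : ℝ) (G : SimpleGraph V) (V₁ : Finset V) :
    {z : V → ℝ | highDegree α ε G z = V₁} =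
      Set.pi Set.univ fun v => noiseSet (24 / ε ^ (1 + α)) (vertexDegree G v) (v ∈ V₁) := by
  ext z
  simp [Finset.ext_iff, highDegree, noiseSet]

theorem pi_laplace_highDegree {ε : ℝ} (hε : 0 < ε) (α : ℝ) (G : SimpleGraph V) (V₁ : Finset V) :
    (Measure.pi fun _ : V => laplace (12 / ε)) {z | highDegree α ε G z = V₁} =
      ∏ v, laplace (12 / ε)
        (noiseSet (24 / ε ^ (1 + α)) (vertexDegree G v) (v ∈ V₁)) := by
  have := isProbabilityMeasure_laplace (b := 12 / ε) (by positivity)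
  rw [setOf_highDegree_eq, Measure.pi_pi]

theorem measurable_comp_highDegree {β : Type*} [MeasurableSpace β] (α ε : ℝ) (G : SimpleGraph V)
    (g : Finset V → β) : Measurable fun z => g (highDegree α ε G z) := by
  intro s _
  have : (fun z => g (highDegree α ε G z)) ⁻¹' s =
      ⋃ V₁ ∈ {V₁ | g V₁ ∈ s}, {z | highDegree α ε G z = V₁} := by
    ext z
    simp
  rw [this]
  refine MeasurableSet.biUnion (Set.to_countable _) fun V₁ _ => ?_
  rw [setOf_highDegree_eq]
  exact MeasurableSet.univ_pi fun v => measurableSet_noiseSet _ _ _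

theorem lintegral_highDegree {ε : ℝ} (α : ℝ) (G : SimpleGraph V)
    (μ : Measure (V → ℝ)) (g : Finset V → ℝ≥0∞) :
    ∫⁻ z, g (highDegree α ε G z) ∂μ = ∑ V₁, μ {z | highDegree α ε G z = V₁} * g V₁ := by
  have hset : ∀ V₁, MeasurableSet {z : V → ℝ | highDegree α ε G z = V₁} := fun V₁ => by
    rw [setOf_highDegree_eq]
    exact MeasurableSet.univ_pi fun v => measurableSet_noiseSet _ _ _
  have : ∀ z, g (highDegree α ε G z) = ∑ V₁, Set.indicator {z | highDegree α ε G z = V₁}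
      (fun _ => g V₁) z := by
    intro z
    rw [Finset.sum_eq_single (highDegree α ε G z)]
    · simp
    · intro V₁ _ hV
      exact Set.indicator_of_notMem (fun h => hV (Eq.symm h)) _
    · simp
  simp_rw [this]
  rw [lintegral_finsetSum _ fun V₁ _ => measurable_const.indicator (hset V₁)]
  refine Finset.sum_congr rfl fun V₁ _ => ?_
  rw [lintegral_indicator_const (hset V₁), mul_comm]

/-- The law of the set of vertices of high noisy degree. -/
def partitionLaw (α : ℝ) {ε : ℝ} (hε : 0 < ε) (G : SimpleGraph V) : PMF (Finset V) :=
  PMF.ofFintype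
    (fun V₁ => (Measure.pi fun _ : V => laplace (12 / ε)) {z | highDegree α ε G z = V₁}) (by
      have := isProbabilityMeasure_laplace (b := 12 / ε) (by positivity)
      have h := lintegral_highDegree (ε := ε) α G (Measure.pi fun _ : V => laplace (12 / ε)) 1
      simpa using h.symm)

theorem partitionLaw_apply (α : ℝ) {ε : ℝ} (hε : 0 < ε) (G : SimpleGraph V) (V₁ : Finset V) :
    partitionLaw α hε G V₁ =
      (Measure.pi fun _ : V => laplace (12 / ε)) {z | highDegree α ε G z = V₁} := rfl

variable [DecidableEq V]

/-- The noise acts only through the partition, which takes finitely many values. From here on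
everything is a finite sum. -/
theorem privateMaxCut_eq (α : ℝ) {ε : ℝ} (hε : 0 < ε) (G : SimpleGraph V) :
    privateMaxCut α ε G = ((partitionLaw α hε G).bind (cutOfPartition α ε G)).toMeasure := by
  ext s hs
  rw [privateMaxCut, Measure.bind_apply hs
    (measurable_comp_highDegree α ε G fun V₁ => (cutOfPartition α ε G V₁).toMeasure).aemeasurable,
    lintegral_highDegree α G _ fun V₁ => (cutOfPartition α ε G V₁).toMeasure s,
    PMF.toMeasure_bind_apply _ _ _ hs, tsum_fintype]
  rfl

theorem integral_privateMaxCut (α : ℝ) {ε : ℝ} (hε : 0 < ε) (G : SimpleGraph V)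
    (f : Cut V → ℝ) :
    ∫ x, f x ∂(privateMaxCut α ε G) =
      mean (partitionLaw α hε G) fun V₁ => mean (cutOfPartition α ε G V₁) f := by
  rw [privateMaxCut_eq α hε, PMF.integral_eq_sum, ← mean_bind, mean_eq_sum]
  rfl

/-- The probability that a vertex of degree `d` is put on a given side. -/
theorem mean_partitionLaw_mem (α : ℝ) {ε : ℝ} (hε : 0 < ε) (G : SimpleGraph V) (v : V)
    (high : Prop) [Decidable high] :
    mean (partitionLaw α hε G) (fun V₁ => if (v ∈ V₁ ↔ high) then 1 else 0) =
      (laplace (12 / ε) (noiseSet (24 / ε ^ (1 + α)) (vertexDegree G v) high)).toReal := by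
  have := isProbabilityMeasure_laplace (b := 12 / ε) (by positivity)
  have h := lintegral_highDegree (ε := ε) α G (Measure.pi fun _ : V => laplace (12 / ε))
    fun V₁ => if (v ∈ V₁ ↔ high) then 1 else 0
  have hset : (Function.eval v : (V → ℝ) → ℝ) ⁻¹'
      noiseSet (24 / ε ^ (1 + α)) (vertexDegree G v) high =
      {z | v ∈ highDegree α ε G z ↔ high} := by
    ext z
    simp [highDegree, noiseSet]
  have hmeas := (measurePreserving_eval (fun _ : V => laplace (12 / ε)) v).measure_preimage
    (measurableSet_noiseSet (24 / ε ^ (1 + α)) (vertexDegree G v) high).nullMeasurableSet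
  rw [hset] at hmeas
  have hind : ∀ z : V → ℝ, (if (v ∈ highDegree α ε G z ↔ high) then (1 : ℝ≥0∞) else 0) =
      Set.indicator {z | v ∈ highDegree α ε G z ↔ high} 1 z := fun z => by
    simp [Set.indicator_apply]
  rw [lintegral_congr hind, lintegral_indicator_one, hmeas] at h
  · rw [h, mean_eq_sum, ENNReal.toReal_sum]
    · refine Finset.sum_congr rfl fun V₁ _ => ?_
      rw [partitionLaw_apply, ENNReal.toReal_mul]
      split_ifs <;> simp
    · intro V₁ _
      refine ENNReal.mul_ne_top (measure_ne_top _ _) ?_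
      split_ifs <;> simp
  · rw [← hset]
    exact measurable_pi_apply v (measurableSet_noiseSet _ _ _)

end Partition

/-! ### Privacy of the partition and of the whole algorithm -/

section PartitionPrivacy

variable {V : Type}

theorem AgreeOff.vertexDegree_le [Finite V] {e₀ : Sym2 V} {G G' : SimpleGraph V}
    (h : AgreeOff e₀ G G') (w : V) : vertexDegree G w ≤ vertexDegree G' w + 1 := by
  -- `z` is the only possible new neighbour: the other endpoint if `w` lies on `e₀`, and an
  -- irrelevant vertex otherwise.
  obtain ⟨z, hz⟩ : ∃ z, ∀ b, b ≠ z → s(w, b) ≠ e₀ := by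
    induction e₀ using Sym2.ind with
    | _ u v =>
      by_cases hw : w = u
      · subst hw
        exact ⟨v, fun b hb h => hb (Sym2.congr_right.1 h)⟩
      · refine ⟨u, fun b hb h => ?_⟩
        rcases Sym2.eq_iff.1 h with ⟨h1, _⟩ | ⟨_, h2⟩
        · exact hw h1
        · exact hb h2
  refine (Set.ncard_le_ncard (t := insert z (G'.neighborSet w)) (fun b hb => ?_)
    (Set.toFinite _)).trans (Set.ncard_insert_le _ _)
  by_cases hbz : b = z
  · exact Or.inl hbz
  · exact Or.inr ((h _ (hz b hbz)).1 hb)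

theorem AgreeOff.vertexDegree_eq {u v : V} {G G' : SimpleGraph V} (h : AgreeOff s(u, v) G G')
    {w : V} (hu : w ≠ u) (hv : w ≠ v) : vertexDegree G w = vertexDegree G' w := by
  unfold vertexDegree
  congr 1
  ext b
  exact h.adj_iff hu hv

theorem laplace_noiseSet_le {ε : ℝ} (hε : 0 < ε) (t : ℝ) {d d' : ℕ} (high : Prop)
    (h : |(d : ℝ) - d'| ≤ 1) :
    laplace (12 / ε) (noiseSet t d high) ≤
      ENNReal.ofReal (Real.exp (ε / 12)) * laplace (12 / ε) (noiseSet t d' high) := by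
  have hset : noiseSet t d high = (fun x => x + ((d : ℝ) - d')) ⁻¹' noiseSet t d' high := by
    ext z
    simp only [noiseSet, Set.mem_ofPred_eq, Set.mem_preimage]
    rw [show (d' : ℝ) + (z + (d - d')) = d + z by ring]
  rw [hset]
  refine (laplace_translate_le (by positivity) _ (measurableSet_noiseSet t d' high)).trans ?_
  refine mul_le_mul_left (ENNReal.ofReal_le_ofReal (Real.exp_le_exp.2 ?_)) _
  rw [div_div_eq_mul_div]
  exact div_le_div_of_nonneg_right (mul_le_of_le_one_left hε.le h) (by norm_num)

variable [Fintype V] [DecidableEq V]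

/-- Only the factors of the endpoints change in the product formula. Their degrees move by at most
one, and each costs `ε/12` at noise scale `12/ε`. -/
theorem ratioLE_partitionLaw (α : ℝ) {ε : ℝ} (hε : 0 < ε) {e₀ : Sym2 V} {G G' : SimpleGraph V}
    (h : AgreeOff e₀ G G') :
    RatioLE (ENNReal.ofReal (Real.exp (ε / 6))) (partitionLaw α hε G) (partitionLaw α hε G') := by
  induction e₀ using Sym2.ind with
  | _ u v =>
    intro V₁
    rw [partitionLaw_apply, partitionLaw_apply, pi_laplace_highDegree hε,
      pi_laplace_highDegree hε]
    set K := ENNReal.ofReal (Real.exp (ε / 12)) with hK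
    have hK1 : 1 ≤ K := by
      rw [hK, ENNReal.one_le_ofReal]
      exact Real.one_le_exp (by positivity)
    have hterm : ∀ w ∈ Finset.univ, laplace (12 / ε)
        (noiseSet (24 / ε ^ (1 + α)) (vertexDegree G w) (w ∈ V₁)) ≤
        (if w ∈ ({u, v} : Finset V) then K else 1) * laplace (12 / ε)
          (noiseSet (24 / ε ^ (1 + α)) (vertexDegree G' w) (w ∈ V₁)) := by
      intro w _
      split_ifs with hw
      · refine laplace_noiseSet_le hε _ _ ?_
        have h1 : (vertexDegree G w : ℝ) ≤ vertexDegree G' w + 1 := by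
          exact_mod_cast h.vertexDegree_le w
        have h2 : (vertexDegree G' w : ℝ) ≤ vertexDegree G w + 1 := by
          exact_mod_cast h.symm.vertexDegree_le w
        rw [abs_le]
        constructor <;> linarith
      · simp only [Finset.mem_insert, Finset.mem_singleton, not_or] at hw
        rw [one_mul, h.vertexDegree_eq hw.1 hw.2]
    refine (Finset.prod_le_prod' hterm).trans ?_
    rw [Finset.prod_mul_distrib]
    gcongr
    rw [Finset.prod_ite_mem, Finset.univ_inter, Finset.prod_const]
    calc K ^ ({u, v} : Finset V).card ≤ K ^ 2 := pow_le_pow_right₀ hK1 Finset.card_le_two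
      _ = ENNReal.ofReal (Real.exp (ε / 6)) := by
        rw [hK, ← ENNReal.ofReal_pow (Real.exp_pos _).le, ← Real.exp_nat_mul]
        congr 2
        push_cast
        ring

theorem isDP_privateMaxCut {α ε : ℝ} (hε : 0 < ε) (hε1 : ε ≤ 0.1)
    (h1 : ε ^ (1 + α) ≤ 0.0106 * ε) :
    IsDP (EdgeNeighbors (V := V)) (privateMaxCut α ε) ε 0 := by
  intro G G' hnbr s hs
  rw [ENNReal.ofReal_zero, add_zero, privateMaxCut_eq α hε, privateMaxCut_eq α hε]
  refine RatioLE.toMeasure ?_ hs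
  rcases Set.encard_le_one_iff_eq.1 hnbr with h | ⟨e₀, h⟩
  · have : G = G' := SimpleGraph.edgeSet_injective (symmDiff_eq_bot.1 h)
    subst this
    refine (RatioLE.refl _).mono ?_
    rw [ENNReal.one_le_ofReal]
    exact Real.one_le_exp hε.le
  · have hagree : AgreeOff e₀ G G' := by
      intro e he
      have : e ∉ symmDiff G.edgeSet G'.edgeSet := by
        rw [h]
        exact he
      rw [Set.mem_symmDiff] at this
      tauto
    have := (ratioLE_partitionLaw α hε hagree).bind
      fun V₁ => ratioLE_cutOfPartition hε.le h1 hε1 hagree V₁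
    rw [← ENNReal.ofReal_mul (Real.exp_pos _).le, ← Real.exp_add,
      show ε / 6 + 5 * ε / 6 = ε by ring] at this
    exact this

end PartitionPrivacy

/-! ### Polynomials of low degree in random signs -/

section Chaos

/-- The sign of a side of a cut. -/
def sgn (b : Bool) : ℝ := if b then 1 else -1

theorem sgn_mul_self (b : Bool) : sgn b * sgn b = 1 := by cases b <;> simp [sgn]

theorem sgn_not (b : Bool) : sgn (!b) = -sgn b := by cases b <;> simp [sgn]

variable {ι : Type} [Fintype ι] [DecidableEq ι]

/-- The product of the signs of the coordinates in `S`. -/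
def walsh (S : Finset ι) (x : ι → Bool) : ℝ := ∏ i ∈ S, sgn (x i)

/-- Change the coordinate `i`. -/
def flipAt (i : ι) : (ι → Bool) ≃ (ι → Bool) :=
  Function.Involutive.toPerm (fun x => Function.update x i (!x i)) fun x => by simp

omit [Fintype ι] in
theorem flipAt_apply (i : ι) (x : ι → Bool) : flipAt i x = Function.update x i (!x i) := rfl

omit [Fintype ι] in
theorem walsh_flipAt {i : ι} {S : Finset ι} (hi : i ∉ S) (x : ι → Bool) :
    walsh S (flipAt i x) = walsh S x := by
  refine Finset.prod_congr rfl fun j hj => ?_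
  rw [flipAt_apply, Function.update_of_ne]
  rintro rfl
  exact hi hj

theorem mean_uniform_eq_half_add (i : ι) (F : (ι → Bool) → ℝ) :
    mean (PMF.uniformOfFintype (ι → Bool)) F =
      mean (PMF.uniformOfFintype (ι → Bool)) fun x => 1 / 2 * (F x + F (flipAt i x)) := by
  rw [mean_const_mul, mean_add, mean_uniform_comp (flipAt i) F]
  ring

theorem sq_mean_mul_le {C : Type} [Fintype C] [Nonempty C] (f g : C → ℝ) :
    mean (PMF.uniformOfFintype C) (fun c => f c * g c) ^ 2 ≤
      mean (PMF.uniformOfFintype C) (fun c => f c ^ 2) *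
        mean (PMF.uniformOfFintype C) (fun c => g c ^ 2) := by
  rw [mean_uniform, mean_uniform, mean_uniform, div_pow, div_mul_div_comm, ← sq]
  exact div_le_div_of_nonneg_right (Finset.sum_mul_sq_le_sq_mul_sq _ _ _) (by positivity)

/-- The second moment of a polynomial in random signs, and Bonami's bound on its fourth moment. -/
theorem moments_walsh (T : Finset ι) : ∀ (d : ℕ) (c : Finset ι → ℝ),
    (∀ S ⊆ T, d < S.card → c S = 0) →
    mean (PMF.uniformOfFintype (ι → Bool)) (fun x => (∑ S ∈ T.powerset, c S * walsh S x) ^ 2) =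
      ∑ S ∈ T.powerset, c S ^ 2 ∧
    mean (PMF.uniformOfFintype (ι → Bool)) (fun x => (∑ S ∈ T.powerset, c S * walsh S x) ^ 4) ≤
      9 ^ d * (∑ S ∈ T.powerset, c S ^ 2) ^ 2 := by
  induction T using Finset.induction_on with
  | empty =>
    intro d c _
    simp only [Finset.powerset_empty, Finset.sum_singleton, walsh, Finset.prod_empty, mul_one,
      mean_const, true_and]
    have : (1 : ℝ) ≤ 9 ^ d := one_le_pow₀ (by norm_num)
    nlinarith [sq_nonneg (c ∅ ^ 2)]
  | insert i T hi ih =>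
    intro d c hc
    set g : (ι → Bool) → ℝ := fun x => ∑ S ∈ T.powerset, c (insert i S) * walsh S x with hg
    set h : (ι → Bool) → ℝ := fun x => ∑ S ∈ T.powerset, c S * walsh S x with hh
    have hnot : ∀ S ∈ T.powerset, i ∉ S := fun S hS hiS => hi (Finset.mem_powerset.1 hS hiS)
    -- Split off one variable: `f = x_i * g + h` with `g` and `h` independent of `x_i`, where `g`
    -- has degree one lower. Averaging over `x_i` removes the odd powers of `x_i`.
    have hf : ∀ x, ∑ S ∈ (insert i T).powerset, c S * walsh S x = sgn (x i) * g x + h x := by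
      intro x
      rw [Finset.sum_powerset_insert hi, add_comm]
      congr 1
      rw [hg, Finset.mul_sum]
      refine Finset.sum_congr rfl fun S hS => ?_
      rw [walsh, Finset.prod_insert (hnot S hS), walsh]
      ring
    have hgflip : ∀ x, g (flipAt i x) = g x := fun x =>
      Finset.sum_congr rfl fun S hS => by rw [walsh_flipAt (hnot S hS)]
    have hhflip : ∀ x, h (flipAt i x) = h x := fun x =>
      Finset.sum_congr rfl fun S hS => by rw [walsh_flipAt (hnot S hS)]
    have hsflip : ∀ x : ι → Bool, sgn (flipAt i x i) = -sgn (x i) := fun x => by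
      rw [flipAt_apply, Function.update_self, sgn_not]
    have hs2 : ∀ x : ι → Bool, sgn (x i) ^ 2 = 1 := fun x => by rw [sq, sgn_mul_self]
    obtain ⟨hh2, hh4⟩ := ih d c fun S hS => hc S (hS.trans (Finset.subset_insert i T))
    have hm2 : mean (PMF.uniformOfFintype (ι → Bool)) (fun x => (sgn (x i) * g x + h x) ^ 2) =
        mean (PMF.uniformOfFintype (ι → Bool)) (fun x => g x ^ 2) +
          mean (PMF.uniformOfFintype (ι → Bool)) (fun x => h x ^ 2) := by
      rw [mean_uniform_eq_half_add i, ← mean_add]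
      refine mean_congr _ fun x _ => ?_
      rw [hgflip, hhflip, hsflip]
      linear_combination g x ^ 2 * hs2 x
    have hm4 : mean (PMF.uniformOfFintype (ι → Bool)) (fun x => (sgn (x i) * g x + h x) ^ 4) =
        mean (PMF.uniformOfFintype (ι → Bool)) (fun x => g x ^ 4) +
          6 * mean (PMF.uniformOfFintype (ι → Bool)) (fun x => g x ^ 2 * h x ^ 2) +
          mean (PMF.uniformOfFintype (ι → Bool)) (fun x => h x ^ 4) := by
      rw [mean_uniform_eq_half_add i, ← mean_const_mul, ← mean_add, ← mean_add]
      refine mean_congr _ fun x _ => ?_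
      rw [hgflip, hhflip, hsflip]
      linear_combination (g x ^ 4 * (sgn (x i) ^ 2 + 1) + 6 * g x ^ 2 * h x ^ 2) * hs2 x
    simp only [hf]
    rw [hm2, hm4, Finset.sum_powerset_insert hi]
    cases d with
    | zero =>
      have hg0 : ∀ S ∈ T.powerset, c (insert i S) = 0 := fun S hS =>
        hc _ (Finset.insert_subset_insert i (Finset.mem_powerset.1 hS)) (by simp)
      have hgz : ∀ x, g x = 0 := fun x =>
        Finset.sum_eq_zero fun S hS => by rw [hg0 S hS, zero_mul]
      have hcz : ∑ S ∈ T.powerset, c (insert i S) ^ 2 = 0 :=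
        Finset.sum_eq_zero fun S hS => by rw [hg0 S hS]; ring
      simp only [hgz, hcz, add_zero]
      norm_num [mean_const]
      exact ⟨hh2, by simpa using hh4⟩
    | succ d =>
      obtain ⟨hg2, hg4⟩ := ih d (fun S => c (insert i S)) fun S hS hcard =>
        hc _ (Finset.insert_subset_insert i hS) (by
          rw [Finset.card_insert_of_notMem fun hiS => hi (hS hiS)]
          omega)
      have hcs := sq_mean_mul_le (fun x => g x ^ 2) (fun x => h x ^ 2)
      simp only [← pow_mul] at hcs
      norm_num at hcs
      set A := ∑ S ∈ T.powerset, c (insert i S) ^ 2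
      set B := ∑ S ∈ T.powerset, c S ^ 2
      have hA : 0 ≤ A := Finset.sum_nonneg fun _ _ => sq_nonneg _
      have hB : 0 ≤ B := Finset.sum_nonneg fun _ _ => sq_nonneg _
      refine ⟨by rw [hg2, hh2, add_comm], ?_⟩
      have hpow : (0 : ℝ) < 9 ^ d := by positivity
      have hG4 : 0 ≤ mean (PMF.uniformOfFintype (ι → Bool)) (fun x => g x ^ 4) :=
        mean_nonneg _ fun x => by positivity
      -- Cauchy–Schwarz on the mixed term: `√(9^d * 9^(d+1)) = 3 * 9^d`. With the factor 6 this is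
      -- `2 * 9^(d+1) * A * B`, exactly the mixed term of `9^(d+1) * (A + B)^2`.
      have hX : mean (PMF.uniformOfFintype (ι → Bool)) (fun x => g x ^ 2 * h x ^ 2) ≤
          9 ^ d * 3 * (A * B) := by
        refine le_of_sq_le_sq ?_ (by positivity)
        refine hcs.trans ((mul_le_mul hg4 hh4 (mean_nonneg _ fun x => by positivity)
          (by positivity)).trans (le_of_eq ?_))
        rw [pow_succ]
        ring
      rw [pow_succ] at hh4 ⊢
      nlinarith [mul_nonneg hpow.le (sq_nonneg A)]

/-- A polynomial of degree at most two in random signs is not concentrated at `0`. -/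
theorem le_mean_abs_walsh (c : Finset ι → ℝ) (hc : ∀ S, 2 < S.card → c S = 0) {a : ℝ}
    (ha : a ≤ ∑ S, c S ^ 2) :
    Real.sqrt a / 25 ≤
      mean (PMF.uniformOfFintype (ι → Bool)) fun x => |∑ S, c S * walsh S x| := by
  obtain ⟨h2, h4⟩ := moments_walsh Finset.univ 2 c fun S _ => hc S
  rw [Finset.powerset_univ] at h2 h4
  set Q := ∑ S, c S ^ 2 with hQ
  set f : (ι → Bool) → ℝ := fun x => ∑ S, c S * walsh S x
  change mean _ (fun x => f x ^ 2) = Q at h2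
  change mean _ (fun x => f x ^ 4) ≤ 9 ^ 2 * Q ^ 2 at h4
  have hQ0 : 0 ≤ Q := Finset.sum_nonneg fun _ _ => sq_nonneg _
  rcases hQ0.eq_or_lt with h0 | hpos
  · rw [Real.sqrt_eq_zero_of_nonpos (ha.trans h0.symm.le), zero_div]
    exact mean_nonneg _ fun x => abs_nonneg _
  · set s := Real.sqrt Q with hs
    have hs0 : 0 < s := Real.sqrt_pos.2 hpos
    have hsQ : s ^ 2 = Q := Real.sq_sqrt hQ0
    -- A lower bound on `|y|` by moments, from `z² - z⁴ ≤ z` at `z = |y| / (13 s)`. With fourth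
    -- moment at most `81 s⁴`, the scale 13 leaves `(1/13 - 81/13³) s = 88/2197 s`, just above
    -- `s/25`.
    have hpt : ∀ y : ℝ, 1 / (13 * s) * y ^ 2 - 1 / (13 * s) ^ 3 * y ^ 4 ≤ |y| := by
      intro y
      have key : ∀ z : ℝ, 0 ≤ z → z ^ 2 - z ^ 4 ≤ z := by
        intro z hz
        rcases le_total z 1 with h1 | h1
        · nlinarith [pow_nonneg hz 4]
        · have : z ^ 2 ≤ z ^ 4 := pow_le_pow_right₀ h1 (by norm_num)
          linarith
      have h13 : 0 < 13 * s := by positivity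
      have := mul_le_mul_of_nonneg_left (key (|y| / (13 * s)) (by positivity)) h13.le
      have e2 : |y| ^ 2 = y ^ 2 := sq_abs y
      have e4 : |y| ^ 4 = y ^ 4 := by rw [show 4 = 2 * 2 by norm_num, pow_mul, pow_mul, e2]
      calc 1 / (13 * s) * y ^ 2 - 1 / (13 * s) ^ 3 * y ^ 4
          = 13 * s * ((|y| / (13 * s)) ^ 2 - (|y| / (13 * s)) ^ 4) := by
            rw [div_pow, div_pow, e2, e4]
            field_simp
        _ ≤ 13 * s * (|y| / (13 * s)) := this
        _ = |y| := by field_simp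
    have hm := mean_mono (PMF.uniformOfFintype (ι → Bool)) fun x => hpt (f x)
    rw [mean_sub, mean_const_mul, mean_const_mul, h2] at hm
    have h5 : 1 / (13 * s) ^ 3 * mean (PMF.uniformOfFintype (ι → Bool)) (fun x => f x ^ 4) ≤
        1 / (13 * s) ^ 3 * (9 ^ 2 * Q ^ 2) := by gcongr
    have h6 : 1 / (13 * s) * Q - 1 / (13 * s) ^ 3 * (9 ^ 2 * Q ^ 2) = 88 / 2197 * s := by
      rw [← hsQ]
      field_simp
      ring
    have h7 : Real.sqrt a ≤ s := Real.sqrt_le_sqrt ha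
    linarith

end Chaos

/-! ### Cuts that are random on a part of the vertices -/

section RandomPart

variable {V : Type}

theorem isSplit_congr {x y : Cut V} {e : Sym2 V} (h : ∀ v ∈ e, x v = y v) :
    IsSplit x e ↔ IsSplit y e := by
  induction e using Sym2.ind with
  | _ u v => rw [isSplit_mk, isSplit_mk, h u (by simp), h v (by simp)]

/-- The cut that agrees with `b` where `P` holds and with `a` elsewhere. -/
def combine (P : V → Prop) [DecidablePred P] (a : Cut V) (b : Cut {v // P v}) : Cut V :=
  fun v => if h : P v then b ⟨v, h⟩ else a v

theorem combine_of_pos {P : V → Prop} [DecidablePred P] (a : Cut V) (b : Cut {v // P v}) {v : V}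
    (h : P v) : combine P a b v = b ⟨v, h⟩ := dif_pos h

theorem combine_of_neg {P : V → Prop} [DecidablePred P] (a : Cut V) (b : Cut {v // P v}) {v : V}
    (h : ¬ P v) : combine P a b v = a v := dif_neg h

/-- Extend a cut of a part of the vertices. -/
def extend {Q : V → Prop} [DecidablePred Q] (a : Cut {v // Q v}) : Cut V :=
  fun v => if h : Q v then a ⟨v, h⟩ else false

theorem extend_of_pos {Q : V → Prop} [DecidablePred Q] (a : Cut {v // Q v}) {v : V} (h : Q v) :
    extend a v = a ⟨v, h⟩ := dif_pos h

section InsideEdges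

variable [Fintype V]

open Classical in
/-- The edges of `G` with both endpoints in `P`. -/
def insideEdges (G : SimpleGraph V) (P : V → Prop) : Finset (Sym2 V) :=
  (edges G).filter fun e => ∀ v ∈ e, P v

theorem mem_insideEdges {G : SimpleGraph V} {P : V → Prop} {e : Sym2 V} :
    e ∈ insideEdges G P ↔ e ∈ G.edgeSet ∧ ∀ v ∈ e, P v := by
  simp [insideEdges]

theorem insideEdges_subset (G : SimpleGraph V) (P : V → Prop) :
    insideEdges G P ⊆ edges G := fun e he => by
  rw [mem_edges]
  exact (mem_insideEdges.1 he).1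

theorem insideEdges_eq_map (G : SimpleGraph V) (P : V → Prop) :
    insideEdges G P = (edges (inducedOn G P)).map
      ⟨Sym2.map Subtype.val, Sym2.map.injective Subtype.val_injective⟩ := by
  ext e
  rw [mem_insideEdges, Finset.mem_map]
  constructor
  · intro he
    induction e using Sym2.ind with
    | _ u v =>
      exact ⟨s(⟨u, he.2 u (by simp)⟩, ⟨v, he.2 v (by simp)⟩), mem_edges.2 he.1, rfl⟩
  · rintro ⟨e, he, rfl⟩
    induction e using Sym2.ind with
    | _ u v =>
      have hadj : (inducedOn G P).Adj u v := mem_edges.1 he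
      refine ⟨hadj, fun w hw => ?_⟩
      rcases Sym2.mem_iff.1 hw with rfl | rfl
      · exact u.2
      · exact v.2

theorem card_edges_inducedOn (G : SimpleGraph V) (P : V → Prop) :
    (edges (inducedOn G P)).card = (insideEdges G P).card := by
  rw [insideEdges_eq_map, Finset.card_map]

theorem cutValue_inducedOn (G : SimpleGraph V) (P : V → Prop) (x : Cut V) :
    cutValue (inducedOn G P) (fun v => x v.1) = ((insideEdges G P).filter (IsSplit x)).card := by
  rw [cutValue_eq_card, insideEdges_eq_map, Finset.filter_map, Finset.card_map]
  congr 1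
  refine Finset.filter_congr fun e _ => ?_
  induction e using Sym2.ind with
  | _ u v => simp

theorem cutValue_eq_sum (G : SimpleGraph V) (x : Cut V) :
    (cutValue G x : ℝ) = ∑ e ∈ edges G, if IsSplit x e then 1 else 0 := by
  rw [cutValue_eq_card, Finset.sum_boole]

end InsideEdges

variable [DecidableEq V]

theorem isSplit_flipAt {x : Cut V} {e : Sym2 V} (he : ¬ e.IsDiag) {v : V} (hv : v ∈ e) :
    IsSplit (flipAt v x) e ↔ ¬ IsSplit x e := by
  obtain ⟨u, rfl⟩ := hv
  have hne : u ≠ v := fun h => he (by simp [h])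
  rw [isSplit_mk, isSplit_mk, flipAt_apply, Function.update_self, Function.update_of_ne hne]
  cases x v <;> cases x u <;> simp

theorem combine_flipAt {P : V → Prop} [DecidablePred P] (a : Cut V) (b : Cut {v // P v})
    (w : {v // P v}) : combine P a (flipAt w b) = flipAt w.1 (combine P a b) := by
  funext v
  by_cases hv : P v
  · by_cases hw : v = w.1
    · subst hw
      simp [combine, flipAt_apply, hv]
    · have : (⟨v, hv⟩ : {v // P v}) ≠ w := fun h => hw (by rw [← h])
      rw [combine_of_pos _ _ hv, flipAt_apply, flipAt_apply, Function.update_of_ne this,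
        Function.update_of_ne hw, combine_of_pos _ _ hv]
  · have hw : v ≠ w.1 := fun h => hv (h ▸ w.2)
    rw [combine_of_neg _ _ hv, flipAt_apply, Function.update_of_ne hw, combine_of_neg _ _ hv]

variable [Fintype V]

/-- The expected value of a cut that is uniform on `P` and fixed elsewhere. -/
theorem mean_cutValue_combine (G : SimpleGraph V) {P Q : V → Prop} [DecidablePred P]
    [DecidablePred Q] (hPQ : ∀ v, Q v ↔ ¬ P v) (a : Cut V) :
    mean (PMF.uniformOfFintype (Cut {v // P v})) (fun b => (cutValue G (combine P a b) : ℝ)) =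
      cutValue (inducedOn G Q) (fun v => a v.1) +
        1 / 2 * (((edges G).card : ℝ) - (insideEdges G Q).card) := by
  have hterm : ∀ e ∈ edges G, mean (PMF.uniformOfFintype (Cut {v // P v}))
      (fun b => if IsSplit (combine P a b) e then 1 else 0) =
      if e ∈ insideEdges G Q then (if IsSplit a e then 1 else 0) else (1 / 2 : ℝ) := by
    intro e he
    rw [mem_edges] at he
    split_ifs with h1 h2
    · have : ∀ b, IsSplit (combine P a b) e := fun b => (isSplit_congr fun v hv =>
        combine_of_neg a b ((hPQ v).1 ((mem_insideEdges.1 h1).2 v hv))).2 h2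
      simp only [this, if_true, mean_const]
    · have : ∀ b, ¬ IsSplit (combine P a b) e := fun b => mt (isSplit_congr fun v hv =>
        combine_of_neg a b ((hPQ v).1 ((mem_insideEdges.1 h1).2 v hv))).1 h2
      simp only [this, if_false, mean_const]
    · rw [mem_insideEdges] at h1
      push Not at h1
      obtain ⟨v, hv, hvQ⟩ := h1 he
      have hvP : P v := by
        rw [hPQ, not_not] at hvQ
        exact hvQ
      -- An edge with an endpoint in `P` is cut in exactly one of `b` and its flip at that endpoint.
      rw [mean_uniform_eq_half_add (⟨v, hvP⟩ : {v // P v}),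
        ← mean_const (PMF.uniformOfFintype (Cut {v // P v})) (1 / 2)]
      refine mean_congr _ fun b _ => ?_
      rw [combine_flipAt, mean_const]
      have := isSplit_flipAt (x := combine P a b) (G.not_isDiag_of_mem_edgeSet he) hv
      by_cases h : IsSplit (combine P a b) e
      · rw [if_pos h, if_neg (this.not.2 (not_not.2 h))]
        norm_num
      · rw [if_neg h, if_pos (this.2 h)]
        norm_num
  simp only [cutValue_eq_sum G]
  rw [mean_sum, Finset.sum_congr rfl hterm, Finset.sum_ite, cutValue_inducedOn,
    Finset.filter_mem_eq_inter, Finset.inter_eq_right.2 (insideEdges_subset G Q),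
    Finset.sum_boole, Finset.sum_const, nsmul_eq_mul, Finset.filter_notMem_eq_sdiff,
    Finset.card_sdiff_of_subset (insideEdges_subset G Q),
    Nat.cast_sub (Finset.card_le_card (insideEdges_subset G Q))]
  ring

theorem prod_sgn_eq {e : Sym2 V} (he : ¬ e.IsDiag) (x : Cut V) :
    (if IsSplit x e then (1 : ℝ) else 0) = 1 / 2 * (1 - ∏ v, if v ∈ e then sgn (x v) else 1) := by
  induction e using Sym2.ind with
  | _ u v =>
    have hne : u ≠ v := by simpa using he
    have : (Finset.univ.filter (· ∈ s(u, v))) = {u, v} := by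
      ext w
      simp
    rw [← Finset.prod_filter, this, Finset.prod_pair hne]
    cases hu : x u <;> cases hv : x v <;> simp [hu, hv, sgn] <;> norm_num

/-- The vertices of `P` that are endpoints of `e`. -/
def endpointsIn (P : V → Prop) [DecidablePred P] (e : Sym2 V) : Finset {v // P v} :=
  Finset.univ.filter fun w => w.1 ∈ e

/-- The sign that the fixed part of a cut contributes to the edge `e`. -/
def outerSign (P : V → Prop) [DecidablePred P] (a : Cut V) (e : Sym2 V) : ℝ :=
  ∏ w : {v // ¬ P v}, if w.1 ∈ e then sgn (a w.1) else 1

theorem prod_sgn_combine (P : V → Prop) [DecidablePred P] (a : Cut V) (b : Cut {v // P v})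
    (e : Sym2 V) : (∏ v, if v ∈ e then sgn (combine P a b v) else 1) =
      outerSign P a e * walsh (endpointsIn P e) b := by
  rw [← Fintype.prod_subtype_mul_prod_subtype P, mul_comm, walsh, endpointsIn, Finset.prod_filter]
  congr 1
  · exact Finset.prod_congr rfl fun w _ => by rw [combine_of_neg a b w.2]
  · exact Finset.prod_congr rfl fun w _ => by rw [combine_of_pos a b w.2]

/-- The Walsh coefficients of the value of a cut that is random on `P`, minus `t`. -/
def cutCoeff (G : SimpleGraph V) (P : V → Prop) [DecidablePred P] (a : Cut V) (t : ℝ)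
    (S : Finset {v // P v}) : ℝ :=
  (if S = ∅ then 1 / 2 * ((edges G).card : ℝ) - t else 0) -
    ∑ e ∈ edges G with endpointsIn P e = S, 1 / 2 * outerSign P a e

theorem cutValue_combine_eq_walsh (G : SimpleGraph V) (P : V → Prop) [DecidablePred P] (a : Cut V)
    (t : ℝ) (b : Cut {v // P v}) :
    (cutValue G (combine P a b) : ℝ) - t = ∑ S, cutCoeff G P a t S * walsh S b := by
  have h1 : (cutValue G (combine P a b) : ℝ) =
      1 / 2 * ((edges G).card : ℝ) -
        ∑ e ∈ edges G, 1 / 2 * outerSign P a e * walsh (endpointsIn P e) b := by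
    rw [cutValue_eq_sum, Finset.sum_congr rfl fun e he =>
      (prod_sgn_eq (G.not_isDiag_of_mem_edgeSet (mem_edges.1 he)) _).trans
        (by rw [prod_sgn_combine, mul_sub, ← mul_assoc]), Finset.sum_sub_distrib,
      Finset.sum_const, nsmul_eq_mul]
    ring
  simp only [cutCoeff, sub_mul, Finset.sum_sub_distrib, ite_mul, zero_mul, Finset.sum_ite_eq',
    Finset.mem_univ, if_true]
  rw [h1, ← Finset.sum_fiberwise (edges G) (endpointsIn P)
    (fun e => 1 / 2 * outerSign P a e * walsh (endpointsIn P e) b)]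
  have hw : walsh ∅ b = 1 := Finset.prod_empty
  have h2 : ∀ S, ∑ e ∈ edges G with endpointsIn P e = S,
      1 / 2 * outerSign P a e * walsh (endpointsIn P e) b =
      (∑ e ∈ edges G with endpointsIn P e = S, 1 / 2 * outerSign P a e) * walsh S b := by
    intro S
    rw [Finset.sum_mul]
    exact Finset.sum_congr rfl fun e he => by rw [(Finset.mem_filter.1 he).2]
  rw [Finset.sum_congr rfl fun S _ => h2 S, hw]
  ring

theorem card_endpointsIn_le (P : V → Prop) [DecidablePred P] (e : Sym2 V) :
    (endpointsIn P e).card ≤ 2 := by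
  induction e using Sym2.ind with
  | _ u v =>
    rw [← Finset.card_map (Function.Embedding.subtype P)]
    refine (Finset.card_le_card (t := {u, v}) fun w hw => ?_).trans Finset.card_le_two
    rw [Finset.mem_map] at hw
    obtain ⟨z, hz, rfl⟩ := hw
    simpa [endpointsIn] using hz

/-- No other edge shares the Walsh monomial of an edge inside `P`. Hence nothing cancels its
coefficient, and the second moment is at least a quarter of the number of such edges, whatever the
fixed part of the cut and the shift `t` are. -/
theorem eq_of_endpointsIn_eq {G : SimpleGraph V} {P : V → Prop} [DecidablePred P] {e e' : Sym2 V}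
    (he : e ∈ insideEdges G P) (h : endpointsIn P e' = endpointsIn P e) : e' = e := by
  rw [mem_insideEdges] at he
  induction e using Sym2.ind with
  | _ u v =>
    have hmem : ∀ w (hw : w ∈ s(u, v)), w ∈ e' := fun w hw => by
      have : (⟨w, he.2 w hw⟩ : {v // P v}) ∈ endpointsIn P e' := by
        rw [h]
        simpa [endpointsIn] using hw
      simpa [endpointsIn] using this
    exact (Sym2.mem_and_mem_iff (SimpleGraph.ne_of_adj G he.1)).1
      ⟨hmem u (by simp), hmem v (by simp)⟩

theorem cutCoeff_eq_zero (G : SimpleGraph V) (P : V → Prop) [DecidablePred P] (a : Cut V) (t : ℝ)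
    (S : Finset {v // P v}) (hS : 2 < S.card) : cutCoeff G P a t S = 0 := by
  have h1 : S ≠ ∅ := by
    rintro rfl
    simp at hS
  rw [cutCoeff, if_neg h1, Finset.sum_eq_zero, sub_zero]
  intro e he
  have := card_endpointsIn_le P e
  rw [(Finset.mem_filter.1 he).2] at this
  omega

theorem cutCoeff_endpointsIn (G : SimpleGraph V) (P : V → Prop) [DecidablePred P] (a : Cut V)
    (t : ℝ) {e : Sym2 V} (he : e ∈ insideEdges G P) :
    cutCoeff G P a t (endpointsIn P e) = -(1 / 2) := by
  have hne : endpointsIn P e ≠ ∅ := by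
    induction e using Sym2.ind with
    | _ u v =>
      refine Finset.ne_empty_of_mem (a := ⟨u, (mem_insideEdges.1 he).2 u (by simp)⟩) ?_
      simp [endpointsIn]
  have hfib : (edges G).filter (fun e' => endpointsIn P e' = endpointsIn P e) = {e} := by
    ext e'
    rw [Finset.mem_filter, Finset.mem_singleton]
    constructor
    · exact fun h => eq_of_endpointsIn_eq he h.2
    · rintro rfl
      exact ⟨insideEdges_subset G P he, rfl⟩
  have hsign : outerSign P a e = 1 := Finset.prod_eq_one fun w _ =>
    if_neg fun hw => w.2 ((mem_insideEdges.1 he).2 _ hw)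
  rw [cutCoeff, if_neg hne, hfib, Finset.sum_singleton, hsign]
  norm_num

/-- The value of a cut that is uniform on `P` fluctuates by the square root of the number of edges
inside of `P`. -/
theorem le_mean_abs_cutValue_sub (G : SimpleGraph V) (P : V → Prop) [DecidablePred P] (a : Cut V)
    (t : ℝ) : Real.sqrt ((insideEdges G P).card) / 50 ≤
      mean (PMF.uniformOfFintype (Cut {v // P v})) fun b =>
        |(cutValue G (combine P a b) : ℝ) - t| := by
  simp only [cutValue_combine_eq_walsh]
  have hsum : ((insideEdges G P).card : ℝ) / 4 ≤ ∑ S, cutCoeff G P a t S ^ 2 := by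
    have hinj : Set.InjOn (endpointsIn P) (insideEdges G P : Set (Sym2 V)) :=
      fun e _ e' he' h => eq_of_endpointsIn_eq he' h
    calc ((insideEdges G P).card : ℝ) / 4
        = ∑ e ∈ insideEdges G P, cutCoeff G P a t (endpointsIn P e) ^ 2 := by
          rw [Finset.sum_congr rfl fun e he => by rw [cutCoeff_endpointsIn G P a t he],
            Finset.sum_const, nsmul_eq_mul]
          ring
      _ = ∑ S ∈ (insideEdges G P).image (endpointsIn P), cutCoeff G P a t S ^ 2 :=
          (Finset.sum_image (f := fun S => cutCoeff G P a t S ^ 2) hinj).symm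
      _ ≤ _ := Finset.sum_le_sum_of_subset_of_nonneg (Finset.subset_univ _)
          fun _ _ _ => sq_nonneg _
  refine le_trans (le_of_eq ?_) (le_mean_abs_walsh (cutCoeff G P a t)
    (fun S hS => cutCoeff_eq_zero G P a t S hS) hsum)
  rw [Real.sqrt_div (by positivity), show (4 : ℝ) = 2 ^ 2 by norm_num,
    Real.sqrt_sq (by norm_num)]
  ring

end RandomPart

/-! ### Expected values of the two random cuts -/

section ExpectedCuts

theorem mean_cutValue_uniform {W : Type} [Fintype W] [DecidableEq W] (H : SimpleGraph W) :
    mean (PMF.uniformOfFintype (Cut W)) (fun x => (cutValue H x : ℝ)) =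
      1 / 2 * ((edges H).card : ℝ) := by
  simp only [cutValue_eq_sum]
  have hterm : ∀ e ∈ edges H, mean (PMF.uniformOfFintype (Cut W))
      (fun x => if IsSplit x e then 1 else 0) = (1 / 2 : ℝ) := by
    intro e he
    rw [mem_edges] at he
    induction e using Sym2.ind with
    | _ u v =>
      rw [mean_uniform_eq_half_add u]
      refine (mean_congr _ fun x _ => ?_).trans (mean_const _ (1 / 2))
      have := isSplit_flipAt (x := x) (H.not_isDiag_of_mem_edgeSet he) (v := u) (by simp)
      by_cases h : IsSplit x s(u, v)
      · rw [if_pos h, if_neg (this.not.2 (not_not.2 h))]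
        norm_num
      · rw [if_neg h, if_pos (this.2 h)]
        norm_num
  rw [mean_sum, Finset.sum_congr rfl hterm, Finset.sum_const, nsmul_eq_mul, mul_comm]

open Classical in
/-- The vertices that are not isolated. -/
def activeVertices {W : Type} [Fintype W] (H : SimpleGraph W) : Finset W :=
  Finset.univ.filter fun w => ∃ b, H.Adj w b

theorem mem_activeVertices {W : Type} [Fintype W] {H : SimpleGraph W} {w : W} :
    w ∈ activeVertices H ↔ ∃ b, H.Adj w b := by simp [activeVertices]

/-- An optimal cut stays optimal under any change on isolated vertices. This family of optima makes
the entropy loss proportional to the number of non-isolated vertices instead of `|W|`. -/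
theorem maxCutValue_sub_le_mean_expMechanism {W : Type} [Fintype W] [DecidableEq W]
    (H : SimpleGraph W) {r : ℝ} (hr : 0 < r) :
    (maxCutValue H : ℝ) - Real.log 2 * (activeVertices H).card / r ≤
      mean (expMechanism r fun x : Cut W => (cutValue H x : ℝ)) fun x => (cutValue H x : ℝ) := by
  classical
  obtain ⟨x₀, -, hx₀⟩ := Finset.exists_mem_eq_sup Finset.univ
    (Finset.univ_nonempty (α := Cut W)) fun x => cutValue H x
  set P : W → Prop := fun w => w ∉ activeVertices H with hP
  have hinj : Function.Injective (combine P x₀) := by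
    intro b b' h
    funext w
    have := congrFun h w.1
    rwa [combine_of_pos _ _ w.2, combine_of_pos _ _ w.2] at this
  have hval : ∀ b, cutValue H (combine P x₀ b) = cutValue H x₀ := by
    intro b
    rw [cutValue_eq_card, cutValue_eq_card]
    congr 1
    refine Finset.filter_congr fun e he => isSplit_congr fun v hv => combine_of_neg _ _ ?_
    obtain ⟨u, rfl⟩ := hv
    rw [hP, not_not, mem_activeVertices]
    exact ⟨u, mem_edges.1 he⟩
  have key := le_mean_expMechanism (M := (maxCutValue H : ℝ)) hr
    (fun x : Cut W => (cutValue H x : ℝ)) (Finset.univ.image (combine P x₀))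
    (Finset.univ_nonempty.image _) fun x hx => by
      obtain ⟨b, -, rfl⟩ := Finset.mem_image.1 hx
      rw [hval, maxCutValue, hx₀]
  refine le_trans (le_of_eq ?_) key
  have hcard : (Fintype.card {w // P w} : ℕ) + (activeVertices H).card = Fintype.card W := by
    have h := Fintype.card_subtype_compl (· ∈ activeVertices H)
    rw [Fintype.card_coe] at h
    have h' := Finset.card_le_univ (activeVertices H)
    have h2 : Fintype.card {w // P w} = Fintype.card W - (activeVertices H).card := by convert h
    omega
  rw [Finset.card_image_of_injective _ hinj, Finset.card_univ, Fintype.card_fun, Fintype.card_fun,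
    Fintype.card_bool, ← hcard, pow_add]
  push_cast
  rw [mul_div_cancel_left₀ _ (by positivity), Real.log_pow]
  ring

variable {V : Type} [Fintype V] [DecidableEq V]

omit [Fintype V] in
theorem concatCut_eq_combine_low (V₁ : Finset V) (a : Cut {v // v ∈ V₁}) (b : Cut {v // v ∉ V₁}) :
    concatCut V₁ a b = combine (· ∉ V₁) (extend a) b := by
  funext v
  by_cases h : v ∈ V₁ <;> simp [concatCut, combine, extend, h]

omit [Fintype V] in
theorem concatCut_eq_combine_high (V₁ : Finset V) (a : Cut {v // v ∈ V₁})
    (b : Cut {v // v ∉ V₁}) : concatCut V₁ a b = combine (· ∈ V₁) (extend b) a := by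
  funext v
  by_cases h : v ∈ V₁ <;> simp [concatCut, combine, extend, h]

omit [Fintype V] [DecidableEq V] in
theorem extend_comp_val {Q : V → Prop} [DecidablePred Q] (a : Cut {v // Q v}) :
    (fun v : {v // Q v} => extend a v.1) = a := by
  funext v
  exact extend_of_pos a v.2

theorem mean_highCut (ε : ℝ) (G : SimpleGraph V) (V₁ : Finset V) :
    mean (highCut ε G V₁) (fun x => (cutValue G x : ℝ)) =
      mean (expMechanism (ε / 12) fun x : Cut {v // v ∈ V₁} =>
        (cutValue (inducedOn G (· ∈ V₁)) x : ℝ))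
        (fun x => (cutValue (inducedOn G (· ∈ V₁)) x : ℝ)) +
      1 / 2 * (((edges G).card : ℝ) - (insideEdges G (· ∈ V₁)).card) := by
  rw [highCut, mean_bind, ← mean_add_const]
  refine mean_congr _ fun a _ => ?_
  simp only [mean_map, concatCut_eq_combine_low]
  rw [mean_cutValue_combine G (P := (· ∉ V₁)) (Q := (· ∈ V₁)) (fun v => not_not.symm),
    extend_comp_val]

theorem mean_lowCut (α ε : ℝ) (G : SimpleGraph V) (V₁ : Finset V) :
    mean (lowCut α ε G V₁) (fun x => (cutValue G x : ℝ)) =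
      mean (matchingCut (ε ^ (1 + α) / 70) (2.5 / 4) (inducedOn G (· ∉ V₁)))
        (fun x => (cutValue (inducedOn G (· ∉ V₁)) x : ℝ)) +
      1 / 2 * (((edges G).card : ℝ) - (insideEdges G (· ∉ V₁)).card) := by
  rw [lowCut, mean_bind, ← mean_add_const]
  refine mean_congr _ fun a _ => ?_
  simp only [mean_map, concatCut_eq_combine_high]
  have key := mean_cutValue_combine G (P := (· ∈ V₁)) (Q := (· ∉ V₁)) (fun v => Iff.rfl)
    (extend a)
  rw [extend_comp_val] at key
  convert key

theorem half_le_mean_highCut {ε : ℝ} (hε : 0 ≤ ε) (G : SimpleGraph V) (V₁ : Finset V) :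
    1 / 2 * ((edges G).card : ℝ) ≤ mean (highCut ε G V₁) fun x => (cutValue G x : ℝ) := by
  have := mean_uniform_le_mean_expMechanism (r := ε / 12) (by positivity)
    fun x : Cut {v // v ∈ V₁} => (cutValue (inducedOn G (· ∈ V₁)) x : ℝ)
  rw [mean_cutValue_uniform, card_edges_inducedOn] at this
  rw [mean_highCut]
  linarith

end ExpectedCuts

/-! ### The gain of the random matching -/

section MatchingGain

variable {W : Type} [DecidableEq W]

theorem isSplit_flipAt_of_notMem {x : Cut W} {e : Sym2 W} {v : W} (hv : v ∉ e) :
    IsSplit (flipAt v x) e ↔ IsSplit x e :=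
  isSplit_congr fun w hw => by
    rw [flipAt_apply, Function.update_of_ne]
    rintro rfl
    exact hv hw

variable [Fintype W]

/-- In a matching, an edge of the matching is cut with the probability of a two-point exponential
mechanism, and every other pair of vertices is cut with probability one half. -/
theorem mean_isSplit_of_matching {M : SimpleGraph W}
    (hM : ∀ u v w, M.Adj u v → M.Adj u w → v = w) (r : ℝ) {e : Sym2 W} (he : ¬ e.IsDiag)
    [Decidable (e ∈ M.edgeSet)] :
    mean (expMechanism r fun x : Cut W => (cutValue M x : ℝ))
        (fun x => if IsSplit x e then 1 else 0) =
      1 / 2 + if e ∈ M.edgeSet then Real.exp r / (1 + Real.exp r) - 1 / 2 else 0 := by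
  rename_i inst
  revert inst
  induction e using Sym2.ind with
  | _ u v =>
    intro inst
    have hsplit : ∀ x : Cut W, IsSplit (flipAt u x) s(u, v) ↔ ¬ IsSplit x s(u, v) := fun x =>
      isSplit_flipAt he (by simp)
    -- If `e` is in `M`, flipping `u` toggles no other edge of `M`, so the score changes by 1. If
    -- not, a score-preserving bijection toggles `e`: flip `u` together with its partner, or `u`
    -- alone if it is unmatched.
    split_ifs with hmem
    · rw [mean_expMechanism_of_equiv r 1 _ (flipAt u) (fun x => IsSplit x s(u, v)) hsplit]
      · rw [mul_one]
        ring
      · intro x hx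
        rw [cutValue_eq_sum, cutValue_eq_sum,
          ← Finset.add_sum_erase _ _ (mem_edges.2 hmem), ← Finset.add_sum_erase (edges M)
            (fun e => if IsSplit (flipAt u x) e then (1 : ℝ) else 0) (mem_edges.2 hmem),
          if_pos hx, if_neg ((hsplit x).not.2 (not_not.2 hx)), zero_add, add_comm]
        congr 1
        refine Finset.sum_congr rfl fun e' he' => ?_
        have hu : u ∉ e' := by
          rintro ⟨w, rfl⟩
          rw [Finset.mem_erase, mem_edges] at he'
          exact he'.1 (by rw [hM u v w hmem he'.2])
        simp only [isSplit_flipAt_of_notMem hu]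
    · rw [add_zero]
      have hhalf : Real.exp (r * 0) / (1 + Real.exp (r * 0)) = 1 / 2 := by norm_num
      by_cases hu : ∃ w, M.Adj u w
      · obtain ⟨w, hw⟩ := hu
        have hwe : w ∉ s(u, v) := by
          rw [Sym2.mem_iff, not_or]
          refine ⟨hw.ne.symm, ?_⟩
          rintro rfl
          exact hmem hw
        rw [mean_expMechanism_of_equiv r 0 _ ((flipAt u).trans (flipAt w))
          (fun x => IsSplit x s(u, v)), hhalf]
        · intro x
          rw [Equiv.trans_apply, isSplit_flipAt_of_notMem hwe, hsplit]
        · intro x _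
          rw [add_zero, Equiv.trans_apply, cutValue_eq_sum, cutValue_eq_sum]
          refine Finset.sum_congr rfl fun e' he' => ?_
          rw [mem_edges] at he'
          have hdiag := M.not_isDiag_of_mem_edgeSet he'
          have hiff : IsSplit (flipAt w (flipAt u x)) e' ↔ IsSplit x e' := by
            by_cases hue : u ∈ e'
            · have hwe' : w ∈ e' := by
                obtain ⟨z, rfl⟩ := hue
                rw [hM u w z hw he']
                simp
              rw [isSplit_flipAt hdiag hwe', isSplit_flipAt hdiag hue, not_not]
            · have hwe' : w ∉ e' := by
                rintro ⟨z, rfl⟩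
                refine hue ?_
                rw [hM w u z hw.symm he']
                simp
              rw [isSplit_flipAt_of_notMem hwe', isSplit_flipAt_of_notMem hue]
          simp only [hiff]
      · rw [mean_expMechanism_of_equiv r 0 _ (flipAt u) (fun x => IsSplit x s(u, v)) hsplit, hhalf]
        intro x _
        rw [add_zero, cutValue_eq_sum, cutValue_eq_sum]
        refine Finset.sum_congr rfl fun e' he' => ?_
        have hue : u ∉ e' := by
          rintro ⟨w, rfl⟩
          exact hu ⟨w, mem_edges.1 he'⟩
        simp only [isSplit_flipAt_of_notMem hue]

omit [DecidableEq W] [Fintype W] in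
theorem mutualChoices_unique (G : SimpleGraph W) (f : W → Option W) (u v w : W)
    (hv : (mutualChoices G f).Adj u v) (hw : (mutualChoices G f).Adj u w) : v = w :=
  Option.some_injective _ (hv.2.1.symm.trans hw.2.1)

open Classical in
/-- The probability that the random matching contains the edge `e`. -/
def matchProb (q : ℝ) (H : SimpleGraph W) (e : Sym2 W) : ℝ :=
  mean (randomMatching q H) fun M => if e ∈ M.edgeSet then 1 else 0

/-- By linearity each edge of `H` is cut with probability one half plus a fixed gain times the
probability of being matched. Unmatched edges lose nothing, which is why a matching is used. -/
theorem mean_matchingCut (q r : ℝ) (H : SimpleGraph W) :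
    mean (matchingCut q r H) (fun x => (cutValue H x : ℝ)) =
      1 / 2 * ((edges H).card : ℝ) +
        (Real.exp r / (1 + Real.exp r) - 1 / 2) * ∑ e ∈ edges H, matchProb q H e := by
  classical
  have hM : ∀ M : SimpleGraph W, (∀ u v w, M.Adj u v → M.Adj u w → v = w) →
      mean (expMechanism r fun x : Cut W => (cutValue M x : ℝ)) (fun x => (cutValue H x : ℝ)) =
        1 / 2 * ((edges H).card : ℝ) + (Real.exp r / (1 + Real.exp r) - 1 / 2) *
          ∑ e ∈ edges H, if e ∈ M.edgeSet then 1 else 0 := by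
    intro M hM
    simp only [cutValue_eq_sum H]
    rw [mean_sum, Finset.sum_congr rfl fun e he => mean_isSplit_of_matching hM r
      (H.not_isDiag_of_mem_edgeSet (mem_edges.1 he)), Finset.sum_add_distrib, Finset.sum_const,
      nsmul_eq_mul, mul_comm, Finset.mul_sum]
    congr 1
    exact Finset.sum_congr rfl fun e _ => by split_ifs <;> ring
  -- Unfolding the law exposes each sample as a `mutualChoices` graph, where the matching property
  -- required by `hM` is available.
  have hrm : ∀ F : SimpleGraph W → ℝ, mean (randomMatching q H) F =
      mean (subsample q H) fun G₂ => mean (independent fun v => chooseNeighbor G₂ v)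
        fun f => F (mutualChoices G₂ f) := fun F => by
    rw [randomMatching_eq, mean_bind]
    simp only [mean_map]
  rw [matchingCut, mean_bind, add_comm]
  simp only [matchProb]
  rw [← mean_sum, ← mean_const_mul, ← mean_add_const, hrm, hrm]
  refine mean_congr _ fun G₂ _ => mean_congr _ fun f _ => ?_
  rw [hM _ (mutualChoices_unique G₂ f), add_comm]

theorem mean_independent_prod {ι : Type} [Fintype ι] [DecidableEq ι] {β : ι → Type}
    [∀ i, Fintype (β i)] (p : ∀ i, PMF (β i)) (h : ∀ i, β i → ℝ) :
    mean (independent p) (fun f => ∏ i, h i (f i)) = ∏ i, mean (p i) (h i) := by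
  simp only [mean_eq_sum]
  rw [Finset.prod_univ_sum, Fintype.piFinset_univ]
  exact Finset.sum_congr rfl fun f _ => by
    rw [independent_apply, ENNReal.toReal_prod, Finset.prod_mul_distrib]

theorem mean_coin {q : ℝ} (h0 : 0 ≤ q) (h1 : q ≤ 1) (f : Bool → ℝ) :
    mean (coin q) f = q * f true + (1 - q) * f false := by
  rw [mean_eq_sum, Fintype.sum_bool, coin_true h1, coin_false h0 h1, ENNReal.toReal_ofReal h0,
    ENNReal.toReal_ofReal (by linarith)]

omit [DecidableEq W] in
theorem eq_some_of_chooseNeighbor_ne_zero {G : SimpleGraph W} {u v : W}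
    (h : ∀ w, G.Adj u w → w = v) (huv : G.Adj u v) {o : Option W}
    (ho : chooseNeighbor G u o ≠ 0) : o = some v := by
  classical
  have hne : (G.neighborFinset u).Nonempty := ⟨v, by simpa using huv⟩
  rw [chooseNeighbor, dif_pos (by convert hne)] at ho
  obtain ⟨w, hw, rfl⟩ := (PMF.mem_support_map_iff _ _ _).1 ((PMF.mem_support_iff _ _).2 ho)
  rw [PMF.mem_support_uniformOfFinset_iff] at hw
  rw [h w (by simpa using hw)]

theorem vertexDegree_eq_card_incident (H : SimpleGraph W) (u : W) :
    vertexDegree H u = ((edges H).filter (u ∈ ·)).card := by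
  classical
  rw [vertexDegree, ← Set.ncard_coe_finset]
  refine Set.ncard_congr (fun b _ => s(u, b)) ?_ ?_ ?_
  · intro b hb
    simpa using hb
  · exact fun b c _ _ h => Sym2.congr_right.1 h
  · intro e he
    simp only [Finset.coe_filter, mem_edges, Set.mem_ofPred_eq] at he
    obtain ⟨h, b, rfl⟩ := he
    exact ⟨b, h, rfl⟩

/-- An edge between vertices of small degree belongs to the random matching with a probability
of the order of the sampling rate. -/
theorem le_matchProb {q : ℝ} (h0 : 0 ≤ q) (h1 : q ≤ 1) (H : SimpleGraph W) {u v : W}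
    (huv : H.Adj u v) :
    q * (1 - q) ^ (vertexDegree H u + vertexDegree H v) ≤ matchProb q H s(u, v) := by
  classical
  -- If `s(u, v)` is kept and every edge in `N` is dropped, then `u` and `v` are each other's only
  -- neighbours and the mutual choice is certain. The function `h` below writes this event as a
  -- product over single coins.
  set N : Finset (Sym2 W) := ((edges H).filter fun e => u ∈ e ∨ v ∈ e).erase s(u, v) with hN
  have hNcard : N.card ≤ vertexDegree H u + vertexDegree H v := by
    rw [vertexDegree_eq_card_incident, vertexDegree_eq_card_incident]
    refine (Finset.card_erase_le).trans ?_
    rw [Finset.filter_or]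
    exact Finset.card_union_le _ _
  set h : Sym2 W → Bool → ℝ := fun e b =>
    if e = s(u, v) then (if b then 1 else 0) else if e ∈ N then (if b then 0 else 1) else 1 with hh
  have hprod : mean (independent fun _ : Sym2 W => coin q) (fun keep => ∏ e, h e (keep e)) =
      q * (1 - q) ^ N.card := by
    rw [mean_independent_prod, ← Finset.mul_prod_erase _ _ (Finset.mem_univ s(u, v))]
    congr 1
    · simp [hh, mean_coin h0 h1]
    · have : ∀ e ∈ Finset.univ.erase s(u, v), mean (coin q) (h e) =
          if e ∈ N then 1 - q else 1 := by
        intro e he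
        have hne : e ≠ s(u, v) := Finset.ne_of_mem_erase he
        rw [mean_coin h0 h1]
        by_cases heN : e ∈ N <;> simp [hh, hne, heN]
      rw [Finset.prod_congr rfl this, Finset.prod_ite_mem, Finset.prod_const,
        Finset.inter_eq_right.2 (Finset.erase_subset_erase _ (Finset.subset_univ _))]
  have hle : mean (independent fun _ : Sym2 W => coin q) (fun keep => ∏ e, h e (keep e)) ≤
      matchProb q H s(u, v) := by
    rw [matchProb, randomMatching_eq, subsample_eq, PMF.bind_map, mean_bind]
    refine mean_mono _ fun keep => ?_
    rw [Function.comp_apply, mean_map]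
    by_cases hgood : ∏ e, h e (keep e) = 0
    · rw [hgood]
      exact mean_nonneg _ fun f => by split_ifs <;> norm_num
    have hne : ∀ e, h e (keep e) ≠ 0 := fun e he =>
      hgood (Finset.prod_eq_zero (Finset.mem_univ e) he)
    have hkuv : keep s(u, v) = true := by
      have := hne s(u, v)
      simpa [hh] using this
    have hkN : ∀ e ∈ N, keep e = false := fun e he => by
      have h1 : e ≠ s(u, v) := Finset.ne_of_mem_erase he
      have := hne e
      simpa [hh, h1, he] using this
    have hone : ∏ e, h e (keep e) ≤ 1 := by
      refine Finset.prod_le_one (fun e _ => ?_) fun e _ => ?_ <;> simp only [hh] <;>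
        split_ifs <;> norm_num
    have hadj : (keptGraph H keep).Adj u v := mem_edgeSet_keptGraph.2 ⟨huv, hkuv⟩
    have hiso : ∀ e ∈ (keptGraph H keep).edgeSet, u ∈ e ∨ v ∈ e → e = s(u, v) := by
      intro e he hinc
      rw [mem_edgeSet_keptGraph] at he
      by_contra hne'
      have := hkN e (Finset.mem_erase.2 ⟨hne', Finset.mem_filter.2 ⟨mem_edges.2 he.1, hinc⟩⟩)
      rw [he.2] at this
      exact Bool.noConfusion this
    refine hone.trans (le_of_eq ?_)
    refine (mean_const (independent fun w => chooseNeighbor (keptGraph H keep) w) 1).symm.trans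
      (mean_congr _ fun f hf => ?_)
    rw [if_pos]
    have hfu : f u = some v := eq_some_of_chooseNeighbor_ne_zero
      (fun w hw => Sym2.congr_right.1 (hiso s(u, w) hw (by simp))) hadj
      (apply_ne_zero_of_independent hf u)
    have hfv : f v = some u := eq_some_of_chooseNeighbor_ne_zero
      (fun w hw => Sym2.congr_right.1 ((hiso s(v, w) hw (by simp)).trans Sym2.eq_swap)) hadj.symm
      (apply_ne_zero_of_independent hf v)
    exact ⟨hadj, hfu, hfv⟩
  refine le_trans ?_ hle
  rw [hprod]
  exact mul_le_mul_of_nonneg_left (pow_le_pow_of_le_one (by linarith) (by linarith) hNcard) h0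

end MatchingGain

/-! ### The quality of the output for a given partition -/

section Selection

variable {V : Type} [Fintype V] [DecidableEq V]

theorem log_three_le : Real.log 3 ≤ 1.2 := by
  rw [Real.log_le_iff_le_exp (by norm_num), show (1.2 : ℝ) = 1 + 0.2 by norm_num, Real.exp_add]
  have h1 := Real.exp_one_gt_d9
  have h2 := Real.add_one_le_exp (0.2 : ℝ)
  nlinarith

/-- The loss is `log 3 / (ε/4)`, at most `4.8/ε`. -/
theorem le_mean_selectCut {ε : ℝ} (hε : 0 < ε) (G : SimpleGraph V) (V₁ : Finset V) (x₁ x₂ : Cut V)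
    (i : Fin 3) :
    (cutValue G ((![x₁, x₂, fun v => decide (v ∈ V₁)] : Fin 3 → Cut V) i) : ℝ) - 5 / ε ≤
      mean (selectCut ε G V₁ x₁ x₂) fun x => (cutValue G x : ℝ) := by
  have h := le_mean_expMechanism (r := ε / 2 / 2) (by positivity)
    (fun i => (cutValue G ((![x₁, x₂, fun v => decide (v ∈ V₁)] : Fin 3 → Cut V) i) : ℝ)) {i}
    (Finset.singleton_nonempty i) fun j hj => by rw [Finset.mem_singleton.1 hj]
  rw [selectCut, mean_map]
  refine le_trans ?_ h
  rw [Fintype.card_fin, Finset.card_singleton, div_div_eq_mul_div]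
  push_cast
  rw [div_one]
  have hlog := log_three_le
  have : Real.log 3 * 2 / (ε / 2) ≤ 5 / ε := by
    rw [div_div_eq_mul_div]
    exact div_le_div_of_nonneg_right (by linarith) hε.le
  have h2 : Real.log 3 / (ε / 2) * 2 = Real.log 3 * 2 / (ε / 2) := by ring
  linarith

theorem card_insideEdges_eq_sum (G : SimpleGraph V) (P : V → Prop) [DecidablePred P] :
    ((insideEdges G P).card : ℝ) = ∑ e ∈ edges G, if ∀ v ∈ e, P v then 1 else 0 := by
  rw [Finset.sum_boole, insideEdges]
  congr!

theorem cutValue_partition (G : SimpleGraph V) (V₁ : Finset V) :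
    (cutValue G (fun v => decide (v ∈ V₁)) : ℝ) = (edges G).card -
      (insideEdges G (· ∈ V₁)).card - (insideEdges G (· ∉ V₁)).card := by
  rw [cutValue_eq_sum, card_insideEdges_eq_sum, card_insideEdges_eq_sum, Finset.card_eq_sum_ones,
    Nat.cast_sum, ← Finset.sum_sub_distrib, ← Finset.sum_sub_distrib]
  refine Finset.sum_congr rfl fun e _ => ?_
  induction e using Sym2.ind with
  | _ u v =>
    by_cases hu : u ∈ V₁ <;> by_cases hv : v ∈ V₁ <;> simp [hu, hv]

/-- The expected value of the output, given the partition. -/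
def partitionValue (α ε : ℝ) (G : SimpleGraph V) (V₁ : Finset V) : ℝ :=
  mean (cutOfPartition α ε G V₁) fun x => (cutValue G x : ℝ)

theorem partitionValue_eq (α ε : ℝ) (G : SimpleGraph V) (V₁ : Finset V) :
    partitionValue α ε G V₁ = mean (highCut ε G V₁) fun x₁ => mean (lowCut α ε G V₁) fun x₂ =>
      mean (selectCut ε G V₁ x₁ x₂) fun x => (cutValue G x : ℝ) := by
  rw [partitionValue, cutOfPartition_eq, mean_bind]
  simp only [mean_bind]

theorem cross_le_partitionValue (α : ℝ) {ε : ℝ} (hε : 0 < ε) (G : SimpleGraph V)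
    (V₁ : Finset V) :
    ((edges G).card : ℝ) - (insideEdges G (· ∈ V₁)).card - (insideEdges G (· ∉ V₁)).card - 5 / ε ≤
      partitionValue α ε G V₁ := by
  rw [partitionValue_eq, ← cutValue_partition,
    ← mean_const (highCut ε G V₁) ((cutValue G fun v => decide (v ∈ V₁)) - 5 / ε)]
  refine mean_mono _ fun x₁ => ?_
  rw [← mean_const (lowCut α ε G V₁) ((cutValue G fun v => decide (v ∈ V₁)) - 5 / ε)]
  exact mean_mono _ fun x₂ => le_mean_selectCut hε G V₁ x₁ x₂ 2

theorem mean_highCut_le_partitionValue (α : ℝ) {ε : ℝ} (hε : 0 < ε) (G : SimpleGraph V)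
    (V₁ : Finset V) :
    mean (highCut ε G V₁) (fun x => (cutValue G x : ℝ)) - 5 / ε ≤ partitionValue α ε G V₁ := by
  rw [partitionValue_eq, sub_eq_add_neg, ← mean_add_const]
  refine mean_mono _ fun x₁ => ?_
  rw [← mean_const (lowCut α ε G V₁) ((cutValue G x₁ : ℝ) + -(5 / ε))]
  exact mean_mono _ fun x₂ => le_mean_selectCut hε G V₁ x₁ x₂ 0

/-- `S₁` is uniform on `V₂`. By Jensen the value of the independent cut `S₂` may be replaced by its
mean, a constant shift to which the fluctuation bound applies. -/
theorem fluctuation_low (α ε : ℝ) (G : SimpleGraph V) (V₁ : Finset V) :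
    Real.sqrt ((insideEdges G (· ∉ V₁)).card) / 50 ≤
      mean (highCut ε G V₁) fun x₁ => mean (lowCut α ε G V₁) fun x₂ =>
        |(cutValue G x₁ : ℝ) - cutValue G x₂| := by
  set t := mean (lowCut α ε G V₁) fun x₂ => (cutValue G x₂ : ℝ) with ht
  refine le_trans (b := mean (highCut ε G V₁) fun x₁ => |(cutValue G x₁ : ℝ) - t|) ?_
    (mean_mono _ fun x₁ => ?_)
  · rw [highCut, mean_bind, ← mean_const (expMechanism (ε / 12) fun x : Cut {v // v ∈ V₁} =>
      (cutValue (inducedOn G (· ∈ V₁)) x : ℝ)) (Real.sqrt _ / 50)]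
    refine mean_mono _ fun a => ?_
    simp only [mean_map, concatCut_eq_combine_low]
    exact le_mean_abs_cutValue_sub G (· ∉ V₁) (extend a) t
  · have h := abs_mean_le (lowCut α ε G V₁) fun x₂ => (cutValue G x₁ : ℝ) - cutValue G x₂
    rwa [mean_sub, mean_const, ← ht] at h

/-- Here the roles are exchanged: `S₂` is uniform on `V₁`, and the value of `S₁`, already fixed, is
the shift. -/
theorem fluctuation_high (α ε : ℝ) (G : SimpleGraph V) (V₁ : Finset V) :
    Real.sqrt ((insideEdges G (· ∈ V₁)).card) / 50 ≤
      mean (highCut ε G V₁) fun x₁ => mean (lowCut α ε G V₁) fun x₂ =>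
        |(cutValue G x₁ : ℝ) - cutValue G x₂| := by
  rw [← mean_const (highCut ε G V₁) (Real.sqrt _ / 50)]
  refine mean_mono _ fun x₁ => ?_
  rw [lowCut, mean_bind, ← mean_const (matchingCut (ε ^ (1 + α) / 70) (2.5 / 4)
    (inducedOn G (· ∉ V₁))) (Real.sqrt _ / 50)]
  refine mean_mono _ fun a => ?_
  simp only [mean_map, concatCut_eq_combine_high]
  have key := le_mean_abs_cutValue_sub G (· ∈ V₁) (extend a) (cutValue G x₁)
  simp only [abs_sub_comm _ (cutValue G x₁ : ℝ)] at key
  convert key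

/-- Uses only that the selection nearly attains the better of `S₁` and `S₂`, with `max x y = (x + y
+ |x - y|) / 2`. -/
theorem average_le_partitionValue (α : ℝ) {ε : ℝ} (hε : 0 < ε) (G : SimpleGraph V)
    (V₁ : Finset V) {F : ℝ} (hF : F ≤ mean (highCut ε G V₁) fun x₁ =>
      mean (lowCut α ε G V₁) fun x₂ => |(cutValue G x₁ : ℝ) - cutValue G x₂|) :
    1 / 2 * (mean (highCut ε G V₁) fun x => (cutValue G x : ℝ)) +
        1 / 2 * (mean (lowCut α ε G V₁) fun x => (cutValue G x : ℝ)) + 1 / 2 * F - 5 / ε ≤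
      partitionValue α ε G V₁ := by
  have hle : mean (highCut ε G V₁) (fun x₁ => mean (lowCut α ε G V₁) fun x₂ =>
      1 / 2 * (cutValue G x₁ : ℝ) + 1 / 2 * (cutValue G x₂ : ℝ) +
        1 / 2 * |(cutValue G x₁ : ℝ) - cutValue G x₂| + -(5 / ε)) ≤
      partitionValue α ε G V₁ := by
    rw [partitionValue_eq]
    refine mean_mono _ fun x₁ => mean_mono _ fun x₂ => ?_
    have h1 := le_mean_selectCut hε G V₁ x₁ x₂ 0
    have h2 := le_mean_selectCut hε G V₁ x₁ x₂ 1
    simp only [Matrix.cons_val_zero, Matrix.cons_val_one] at h1 h2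
    rcases le_total (cutValue G x₁ : ℝ) (cutValue G x₂) with h | h
    · rw [abs_of_nonpos (by linarith)]
      linarith
    · rw [abs_of_nonneg (by linarith)]
      linarith
  simp only [mean_add_const, mean_add, mean_const_mul, mean_const] at hle
  linarith

end Selection

/-! ### Counting edges and degrees -/

section Counting

variable {V : Type} [Fintype V] [DecidableEq V]

theorem maxCutValue_le_card (G : SimpleGraph V) : maxCutValue G ≤ (edges G).card :=
  Finset.sup_le fun x _ => by
    rw [cutValue_eq_card]
    exact Finset.card_filter_le _ _

theorem half_le_maxCutValue (G : SimpleGraph V) :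
    1 / 2 * ((edges G).card : ℝ) ≤ maxCutValue G := by
  rw [← mean_cutValue_uniform, ← mean_const (PMF.uniformOfFintype (Cut V)) (maxCutValue G : ℝ)]
  exact mean_mono _ fun x => by
    exact_mod_cast Finset.le_sup (f := fun x => cutValue G x) (Finset.mem_univ x)

theorem maxCutValue_le_add (G : SimpleGraph V) (V₁ : Finset V) :
    (maxCutValue G : ℝ) ≤ maxCutValue (inducedOn G (· ∈ V₁)) +
      ((edges G).card - (insideEdges G (· ∈ V₁)).card) := by
  obtain ⟨x, -, hx⟩ := Finset.exists_mem_eq_sup Finset.univ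
    (Finset.univ_nonempty (α := Cut V)) fun x => cutValue G x
  have h1 : cutValue (inducedOn G (· ∈ V₁)) (fun v => x v.1) ≤
      maxCutValue (inducedOn G (· ∈ V₁)) :=
    Finset.le_sup (f := fun x => cutValue (inducedOn G (· ∈ V₁)) x) (Finset.mem_univ _)
  have h2 : cutValue G x + (insideEdges G (· ∈ V₁)).card ≤
      cutValue (inducedOn G (· ∈ V₁)) (fun v => x v.1) + (edges G).card := by
    rw [cutValue_inducedOn, cutValue_eq_card]
    have hsub : (edges G).filter (IsSplit x) ⊆
        (insideEdges G (· ∈ V₁)).filter (IsSplit x) ∪ (edges G \ insideEdges G (· ∈ V₁)) := by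
      intro e he
      rw [Finset.mem_filter] at he
      by_cases h : e ∈ insideEdges G (· ∈ V₁)
      · exact Finset.mem_union_left _ (Finset.mem_filter.2 ⟨h, he.2⟩)
      · exact Finset.mem_union_right _ (Finset.mem_sdiff.2 ⟨he.1, h⟩)
    have h3 := (Finset.card_le_card hsub).trans (Finset.card_union_le _ _)
    have h4 := Finset.card_sdiff_add_card_eq_card (insideEdges_subset G (· ∈ V₁))
    omega
  have h5 : maxCutValue G = cutValue G x := hx
  rw [h5]
  have h1' : (cutValue (inducedOn G (· ∈ V₁)) (fun v => x v.1) : ℝ) ≤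
      maxCutValue (inducedOn G (· ∈ V₁)) := by exact_mod_cast h1
  have h2' : (cutValue G x : ℝ) + (insideEdges G (· ∈ V₁)).card ≤
      cutValue (inducedOn G (· ∈ V₁)) (fun v => x v.1) + (edges G).card := by exact_mod_cast h2
  linarith

/-- Edges inside `V₁` count twice and crossing edges once: `2a + (m - a - d) = m + a - d`. -/
theorem sum_vertexDegree_le (G : SimpleGraph V) (V₁ : Finset V) :
    ∑ v ∈ V₁, (vertexDegree G v : ℝ) ≤ (edges G).card + (insideEdges G (· ∈ V₁)).card -
      (insideEdges G (· ∉ V₁)).card := by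
  have hdeg : ∀ v, (vertexDegree G v : ℝ) = ∑ e ∈ edges G, if v ∈ e then 1 else 0 := fun v => by
    rw [Finset.sum_boole, vertexDegree_eq_card_incident]
  simp only [hdeg]
  rw [Finset.sum_comm, card_insideEdges_eq_sum, card_insideEdges_eq_sum, Finset.card_eq_sum_ones,
    Nat.cast_sum, ← Finset.sum_add_distrib, ← Finset.sum_sub_distrib]
  refine Finset.sum_le_sum fun e he => ?_
  induction e using Sym2.ind with
  | _ u v =>
    have hne : u ≠ v := SimpleGraph.ne_of_adj G (mem_edges.1 he)
    have : ∑ w ∈ V₁, (if w ∈ s(u, v) then (1 : ℝ) else 0) =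
        (if u ∈ V₁ then 1 else 0) + if v ∈ V₁ then 1 else 0 := by
      rw [← Finset.sum_ite_eq V₁ u fun _ => (1 : ℝ), ← Finset.sum_ite_eq V₁ v fun _ => (1 : ℝ),
        ← Finset.sum_add_distrib]
      refine Finset.sum_congr rfl fun w _ => ?_
      by_cases h1 : u = w
      · subst h1
        simp [hne.symm]
      · by_cases h2 : v = w
        · subst h2
          simp [h1]
        · simp [h1, h2, Ne.symm h1, Ne.symm h2]
    rw [this]
    by_cases hu : u ∈ V₁ <;> by_cases hv : v ∈ V₁ <;> simp [hu, hv]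

omit [DecidableEq V] in
theorem vertexDegree_inducedOn_le (G : SimpleGraph V) (P : V → Prop) (v : {v // P v}) :
    vertexDegree (inducedOn G P) v ≤ vertexDegree G v.1 := by
  unfold vertexDegree
  rw [← Set.ncard_image_of_injective _ Subtype.val_injective]
  refine Set.ncard_le_ncard ?_ (Set.toFinite _)
  rintro _ ⟨w, hw, rfl⟩
  exact hw

/-- The vertices of `V₁` with an edge but of degree less than `t`. -/
def lowInHigh (G : SimpleGraph V) (t : ℝ) (V₁ : Finset V) : Finset V :=
  V₁.filter fun v => 1 ≤ vertexDegree G v ∧ (vertexDegree G v : ℝ) < t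

open Classical in
/-- The edges outside of `V₁` with an endpoint of degree more than `t`. -/
def highInLow (G : SimpleGraph V) (t : ℝ) (V₁ : Finset V) : Finset (Sym2 V) :=
  (insideEdges G (· ∉ V₁)).filter fun e => ∃ v ∈ e, t < (vertexDegree G v : ℝ)

/-- A non-isolated vertex of the induced graph either belongs to `lowInHigh` or has degree at least
`t` in `G`; the latter are bounded by Markov's inequality on the degree sum. -/
theorem mul_card_activeVertices_le (G : SimpleGraph V) {t : ℝ} (ht : 0 < t) (V₁ : Finset V) :
    t * (activeVertices (inducedOn G (· ∈ V₁))).card ≤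
      t * (lowInHigh G t V₁).card + ((edges G).card + (insideEdges G (· ∈ V₁)).card -
        (insideEdges G (· ∉ V₁)).card) := by
  have hsub : (activeVertices (inducedOn G (· ∈ V₁))).map (Function.Embedding.subtype _) ⊆
      lowInHigh G t V₁ ∪ V₁.filter fun v => t ≤ (vertexDegree G v : ℝ) := by
    intro v hv
    obtain ⟨w, hw, rfl⟩ := Finset.mem_map.1 hv
    obtain ⟨b, hb⟩ := mem_activeVertices.1 hw
    rw [Finset.mem_union, lowInHigh, Finset.mem_filter, Finset.mem_filter]
    have h1 : 1 ≤ vertexDegree G w.1 :=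
      (Set.ncard_pos (Set.toFinite _)).2 ⟨b.1, hb⟩
    rcases lt_or_ge (vertexDegree G w.1 : ℝ) t with h | h
    · exact Or.inl ⟨w.2, h1, h⟩
    · exact Or.inr ⟨w.2, h⟩
  have hcard := (Finset.card_le_card hsub).trans (Finset.card_union_le _ _)
  rw [Finset.card_map] at hcard
  have hcard' : ((activeVertices (inducedOn G (· ∈ V₁))).card : ℝ) ≤
      (lowInHigh G t V₁).card + (V₁.filter fun v => t ≤ (vertexDegree G v : ℝ)).card := by
    exact_mod_cast hcard
  have hsum : t * (V₁.filter fun v => t ≤ (vertexDegree G v : ℝ)).card ≤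
      ∑ v ∈ V₁, (vertexDegree G v : ℝ) := by
    calc t * (V₁.filter fun v => t ≤ (vertexDegree G v : ℝ)).card
        = ∑ _v ∈ V₁.filter fun v => t ≤ (vertexDegree G v : ℝ), t := by
          rw [Finset.sum_const, nsmul_eq_mul, mul_comm]
      _ ≤ ∑ v ∈ V₁.filter fun v => t ≤ (vertexDegree G v : ℝ), (vertexDegree G v : ℝ) :=
          Finset.sum_le_sum fun v hv => (Finset.mem_filter.1 hv).2
      _ ≤ _ := Finset.sum_le_sum_of_subset_of_nonneg (Finset.filter_subset _ _)
          fun _ _ _ => Nat.cast_nonneg _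
  have := sum_vertexDegree_le G V₁
  have h2 := mul_le_mul_of_nonneg_left hcard' ht.le
  linarith

/-- The expected value of `S₂` exceeds half of the edges in proportion to the number of edges
between vertices of low degree. -/
theorem le_mean_lowCut {α ε : ℝ} (hη : 0 < ε ^ (1 + α)) (hη1 : ε ^ (1 + α) ≤ 1)
    (G : SimpleGraph V) (V₁ : Finset V) :
    1 / 2 * ((edges G).card : ℝ) + ε ^ (1 + α) / 15000 *
      ((insideEdges G (· ∉ V₁)).card - (highInLow G (45.6 / ε ^ (1 + α)) V₁).card) ≤
    mean (lowCut α ε G V₁) fun x => (cutValue G x : ℝ) := by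
  classical
  set η := ε ^ (1 + α) with hηdef
  set H := inducedOn G (· ∉ V₁) with hH
  have hsum : η / 70 / 21 *
      ((insideEdges G (· ∉ V₁)).card - (highInLow G (45.6 / η) V₁).card) ≤
      ∑ e ∈ edges H, matchProb (η / 70) H e := by
    have hcount : ((insideEdges G (· ∉ V₁)).card : ℝ) - (highInLow G (45.6 / η) V₁).card =
        ∑ e ∈ edges H, if ∃ v ∈ e.map Subtype.val, 45.6 / η < (vertexDegree G v : ℝ)
          then 0 else 1 := by
      have h1 : ((insideEdges G (· ∉ V₁)).card : ℝ) - (highInLow G (45.6 / η) V₁).card =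
          ∑ e ∈ insideEdges G (· ∉ V₁), if ∃ v ∈ e, 45.6 / η < (vertexDegree G v : ℝ)
            then 0 else 1 := by
        rw [highInLow, ← Finset.sum_boole, Finset.card_eq_sum_ones, Nat.cast_sum,
          ← Finset.sum_sub_distrib]
        refine Finset.sum_congr rfl fun e _ => ?_
        split_ifs <;> simp
      rw [h1, insideEdges_eq_map, Finset.sum_map]
      rfl
    rw [hcount, Finset.mul_sum]
    refine Finset.sum_le_sum fun e he => ?_
    split_ifs with hlow
    · rw [mul_zero]
      exact mean_nonneg _ fun M => by split_ifs <;> norm_num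
    · rw [mul_one]
      push Not at hlow
      induction e using Sym2.ind with
      | _ u v =>
        have hq0 : 0 ≤ η / 70 := by positivity
        refine le_trans ?_ (le_matchProb hq0 (by linarith) H (mem_edges.1 he))
        have hu := hlow u.1 (by simp)
        have hv := hlow v.1 (by simp)
        have hdu : (vertexDegree H u : ℝ) ≤ vertexDegree G u.1 := by
          exact_mod_cast vertexDegree_inducedOn_le G _ u
        have hdv : (vertexDegree H v : ℝ) ≤ vertexDegree G v.1 := by
          exact_mod_cast vertexDegree_inducedOn_le G _ v
        set N := vertexDegree H u + vertexDegree H v with hN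
        -- Two endpoints of degree at most `45.6/η`. With `1 - x ≥ exp (-2x)` the survival factor is
        -- at least `exp (-2 * 91.2 / 70) ≥ exp (-3) ≥ 1/21`.
        have hNle : η * (N : ℝ) ≤ 91.2 := by
          have : (N : ℝ) ≤ 91.2 / η := by
            rw [hN]
            push_cast
            have : 91.2 / η = 45.6 / η + 45.6 / η := by ring
            linarith
          rw [le_div_iff₀ hη] at this
          linarith
        have hexp : Real.exp (-(2 * (η / 70))) ≤ 1 - η / 70 := by
          have h1 := Real.add_one_le_exp (2 * (η / 70))
          rw [Real.exp_neg, inv_le_comm₀ (Real.exp_pos _) (by linarith)]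
          refine le_trans ?_ h1
          rw [inv_le_iff_one_le_mul₀ (by linarith)]
          nlinarith
        have hpow : (1 : ℝ) / 21 ≤ (1 - η / 70) ^ N := by
          calc (1 : ℝ) / 21 ≤ Real.exp (-3) := by
                rw [Real.exp_neg, one_div, inv_le_inv₀ (by norm_num) (Real.exp_pos _)]
                calc Real.exp 3 = Real.exp 1 ^ 3 := by rw [← Real.exp_nat_mul]; norm_num
                  _ ≤ 2.7182818286 ^ 3 := by gcongr; exact Real.exp_one_lt_d9.le
                  _ ≤ 21 := by norm_num
            _ ≤ Real.exp (N * -(2 * (η / 70))) := Real.exp_le_exp.2 (by linarith)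
            _ = Real.exp (-(2 * (η / 70))) ^ N := Real.exp_nat_mul _ _
            _ ≤ _ := pow_le_pow_left₀ (Real.exp_pos _).le hexp N
        calc η / 70 / 21 = η / 70 * (1 / 21) := by ring
          _ ≤ _ := mul_le_mul_of_nonneg_left hpow hq0
  -- Advantage of a matched edge at rate `2.5/4`. Altogether the gain per edge is `η / (10 * 70 *
  -- 21) = η / 14700`, rounded down to `η / 15000`.
  have hdelta : (1 : ℝ) / 10 ≤ Real.exp (2.5 / 4) / (1 + Real.exp (2.5 / 4)) - 1 / 2 := by
    have h1 := Real.add_one_le_exp (2.5 / 4 : ℝ)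
    have h2 : (6 : ℝ) / 10 ≤ Real.exp (2.5 / 4) / (1 + Real.exp (2.5 / 4)) := by
      rw [le_div_iff₀ (by positivity)]
      linarith
    linarith
  have hnonneg : (0 : ℝ) ≤ (insideEdges G (· ∉ V₁)).card - (highInLow G (45.6 / η) V₁).card := by
    rw [sub_nonneg]
    exact_mod_cast Finset.card_filter_le _ _
  rw [mean_lowCut, mean_matchingCut, card_edges_inducedOn, ← hηdef, ← hH]
  have hmul := mul_le_mul hdelta hsum (by positivity) (by linarith)
  have hlin : η / 15000 * ((insideEdges G (· ∉ V₁)).card - (highInLow G (45.6 / η) V₁).card) ≤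
      1 / 10 * (η / 70 / 21 *
        ((insideEdges G (· ∉ V₁)).card - (highInLow G (45.6 / η) V₁).card)) := by
    have := mul_nonneg hη.le hnonneg
    linarith
  linarith

end Counting

/-! ### Most partitions are good -/

section Tails

variable {V : Type} [Fintype V] [DecidableEq V]

/-- The degree bounds `2.4/η` and `45.6/η` lie symmetrically at distance `21.6/η` from the threshold
`24/η`. In units of the noise scale this is `1.8 / ε ^ α`, and the second part of admissibility says
that it is at least `log (10/η)`. -/
theorem laplace_tail_le {α ε : ℝ} (hε : 0 < ε) (hε1 : ε ≤ 0.1) (hα : 0 < α)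
    (hadm : Admissible α ε) :
    1 / 2 * Real.exp (-(21.6 / ε ^ (1 + α)) / (12 / ε)) ≤ ε ^ (1 + α) / 20 := by
  have hη : 0 < ε ^ (1 + α) := Real.rpow_pos_of_pos hε _
  have hηeq : ε ^ (1 + α) = ε * ε ^ α := by rw [Real.rpow_add hε, Real.rpow_one]
  have hεα : 0 < ε ^ α := Real.rpow_pos_of_pos hε _
  have hη1 : ε ^ (1 + α) ≤ 1 := Real.rpow_le_one hε.le (by linarith) (by linarith)
  have hlogpos : 0 < Real.log (10 / ε ^ (1 + α)) := by
    refine Real.log_pos ?_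
    rw [lt_div_iff₀ hη]
    linarith
  have h1 : ε ^ α ≤ 1.8 / Real.log (10 / ε ^ (1 + α)) := hadm.trans (min_le_right _ _)
  have h2 : Real.log (10 / ε ^ (1 + α)) ≤ 1.8 / ε ^ α := by
    rw [le_div_iff₀ hlogpos] at h1
    rw [le_div_iff₀ hεα]
    linarith
  have h3 : -(21.6 / ε ^ (1 + α)) / (12 / ε) = -(1.8 / ε ^ α) := by
    rw [hηeq]
    field_simp
    norm_num
  have h4 : Real.exp (-(1.8 / ε ^ α)) ≤ ε ^ (1 + α) / 10 := by
    calc Real.exp (-(1.8 / ε ^ α)) ≤ Real.exp (-Real.log (10 / ε ^ (1 + α))) :=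
          Real.exp_le_exp.2 (neg_le_neg h2)
      _ = ε ^ (1 + α) / 10 := by
        rw [Real.exp_neg, Real.exp_log (by positivity), inv_div]
  rw [h3]
  linarith

theorem mean_mem_le {α ε : ℝ} (hε : 0 < ε) (hε1 : ε ≤ 0.1) (hα : 0 < α)
    (hadm : Admissible α ε) (G : SimpleGraph V) (v : V)
    (hv : (vertexDegree G v : ℝ) < 2.4 / ε ^ (1 + α)) :
    mean (partitionLaw α hε G) (fun V₁ => if (v ∈ V₁ ↔ True) then 1 else 0) ≤
      ε ^ (1 + α) / 20 := by
  refine le_trans ?_ (laplace_tail_le hε hε1 hα hadm)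
  have hη : 0 < ε ^ (1 + α) := Real.rpow_pos_of_pos hε _
  rw [mean_partitionLaw_mem]
  refine ENNReal.toReal_le_of_le_ofReal (by positivity) ?_
  rw [← laplace_Ioi (by positivity) (by positivity)]
  refine measure_mono fun z hz => ?_
  have hz' : 24 / ε ^ (1 + α) < (vertexDegree G v : ℝ) + z := by simpa [noiseSet] using hz
  have : 24 / ε ^ (1 + α) = 21.6 / ε ^ (1 + α) + 2.4 / ε ^ (1 + α) := by
    rw [← add_div]
    norm_num
  rw [Set.mem_Ioi]
  linarith

theorem mean_notMem_le {α ε : ℝ} (hε : 0 < ε) (hε1 : ε ≤ 0.1) (hα : 0 < α)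
    (hadm : Admissible α ε) (G : SimpleGraph V) (v : V)
    (hv : 45.6 / ε ^ (1 + α) < (vertexDegree G v : ℝ)) :
    mean (partitionLaw α hε G) (fun V₁ => if (v ∈ V₁ ↔ False) then 1 else 0) ≤
      ε ^ (1 + α) / 20 := by
  refine le_trans ?_ (laplace_tail_le hε hε1 hα hadm)
  have hη : 0 < ε ^ (1 + α) := Real.rpow_pos_of_pos hε _
  rw [mean_partitionLaw_mem]
  refine ENNReal.toReal_le_of_le_ofReal (by positivity) ?_
  rw [← laplace_Iic (by positivity) (by positivity)]
  refine measure_mono fun z hz => ?_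
  have hz' : (vertexDegree G v : ℝ) + z ≤ 24 / ε ^ (1 + α) := by simpa [noiseSet] using hz
  have : 45.6 / ε ^ (1 + α) = 21.6 / ε ^ (1 + α) + 24 / ε ^ (1 + α) := by
    rw [← add_div]
    norm_num
  rw [Set.mem_Iic]
  linarith

theorem card_le_two_mul_edges (G : SimpleGraph V) :
    ((Finset.univ.filter fun v => 1 ≤ vertexDegree G v).card : ℝ) ≤ 2 * (edges G).card := by
  have h1 := sum_vertexDegree_le G Finset.univ
  have h2 : ((insideEdges G (· ∈ (Finset.univ : Finset V))).card : ℝ) ≤ (edges G).card := by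
    exact_mod_cast Finset.card_le_card (insideEdges_subset G _)
  have h3 : ((Finset.univ.filter fun v => 1 ≤ vertexDegree G v).card : ℝ) ≤
      ∑ v, (vertexDegree G v : ℝ) := by
    rw [← Finset.sum_boole]
    refine Finset.sum_le_sum fun v _ => ?_
    split_ifs with h
    · exact_mod_cast h
    · exact Nat.cast_nonneg _
  have h4 : (0 : ℝ) ≤ (insideEdges G (· ∉ (Finset.univ : Finset V))).card := Nat.cast_nonneg _
  linarith

/-- At most `2m` vertices are non-isolated, and each low one is misplaced with probability at most
`η/20`. -/
theorem mean_card_lowInHigh_le {α ε : ℝ} (hε : 0 < ε) (hε1 : ε ≤ 0.1) (hα : 0 < α)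
    (hadm : Admissible α ε) (G : SimpleGraph V) :
    mean (partitionLaw α hε G)
        (fun V₁ => ((lowInHigh G (2.4 / ε ^ (1 + α)) V₁).card : ℝ)) ≤
      0.1 * ε ^ (1 + α) * (edges G).card := by
  have hη : 0 < ε ^ (1 + α) := Real.rpow_pos_of_pos hε _
  set L := Finset.univ.filter fun v => 1 ≤ vertexDegree G v ∧
    (vertexDegree G v : ℝ) < 2.4 / ε ^ (1 + α) with hL
  have hcard : ∀ V₁, ((lowInHigh G (2.4 / ε ^ (1 + α)) V₁).card : ℝ) =
      ∑ v ∈ L, if (v ∈ V₁ ↔ True) then 1 else 0 := by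
    intro V₁
    rw [Finset.sum_boole, lowInHigh, hL]
    congr 2
    ext v
    simp [and_comm]
  simp only [hcard]
  rw [mean_sum]
  calc _ ≤ ∑ _v ∈ L, ε ^ (1 + α) / 20 := Finset.sum_le_sum fun v hv =>
        mean_mem_le hε hε1 hα hadm G v (Finset.mem_filter.1 hv).2.2
    _ = L.card * (ε ^ (1 + α) / 20) := by rw [Finset.sum_const, nsmul_eq_mul]
    _ ≤ (2 * (edges G).card) * (ε ^ (1 + α) / 20) := by
        gcongr
        have hsub : L ⊆ Finset.univ.filter fun v => 1 ≤ vertexDegree G v := fun v hv =>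
          Finset.mem_filter.2 ⟨Finset.mem_univ v, (Finset.mem_filter.1 hv).2.1⟩
        refine le_trans ?_ (card_le_two_mul_edges G)
        exact_mod_cast Finset.card_le_card hsub
    _ = _ := by ring

/-- For such an edge to stay outside of `V₁`, its high-degree endpoint must be misplaced. -/
theorem mean_card_highInLow_le {α ε : ℝ} (hε : 0 < ε) (hε1 : ε ≤ 0.1) (hα : 0 < α)
    (hadm : Admissible α ε) (G : SimpleGraph V) :
    mean (partitionLaw α hε G)
        (fun V₁ => ((highInLow G (45.6 / ε ^ (1 + α)) V₁).card : ℝ)) ≤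
      ε ^ (1 + α) / 20 * (edges G).card := by
  classical
  have hη : 0 < ε ^ (1 + α) := Real.rpow_pos_of_pos hε _
  have hcard : ∀ V₁, ((highInLow G (45.6 / ε ^ (1 + α)) V₁).card : ℝ) =
      ∑ e ∈ edges G, if (∀ v ∈ e, v ∉ V₁) ∧ ∃ v ∈ e, 45.6 / ε ^ (1 + α) < (vertexDegree G v : ℝ)
        then 1 else 0 := by
    intro V₁
    rw [Finset.sum_boole, highInLow, insideEdges, Finset.filter_filter]
    congr!
  simp only [hcard]
  rw [mean_sum]
  calc _ ≤ ∑ _e ∈ edges G, ε ^ (1 + α) / 20 := Finset.sum_le_sum fun e _ => ?_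
    _ = _ := by rw [Finset.sum_const, nsmul_eq_mul, mul_comm]
  by_cases h : ∃ v ∈ e, 45.6 / ε ^ (1 + α) < (vertexDegree G v : ℝ)
  · obtain ⟨v, hve, hv⟩ := h
    refine (mean_mono _ fun V₁ => ?_).trans (mean_notMem_le hε hε1 hα hadm G v hv)
    by_cases hmem : v ∈ V₁
    · rw [if_neg fun hh => hh.1 v hve hmem]
      split_ifs <;> norm_num
    · rw [if_pos (show v ∈ V₁ ↔ False by simpa using hmem)]
      split_ifs <;> norm_num
  · simp only [h, and_false, if_false, mean_const]
    positivity

end Tails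

/-! ### The expected value of the output -/

section Utility

variable {V : Type} [Fintype V] [DecidableEq V]

theorem five_div_le {ε m : ℝ} (hm : 4000000 / ε ^ 2 ≤ m) :
    5 / ε ≤ Real.sqrt m / 400 := by
  have h : 2000 / ε ≤ Real.sqrt m := by
    refine Real.le_sqrt_of_sq_le (le_trans (le_of_eq ?_) hm)
    rw [div_pow]
    norm_num
  calc 5 / ε = 2000 / ε / 400 := by ring
    _ ≤ _ := by gcongr

theorem five_div_le_mul {ε m : ℝ} (hε : 0 < ε) (hε1 : ε ≤ 0.1) (hm : 4000000 / ε ^ 2 ≤ m) :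
    5 / ε ≤ m / 1000 := by
  refine le_trans ?_ (div_le_div_of_nonneg_right hm (by norm_num))
  rw [div_div, div_le_div_iff₀ hε (by positivity)]
  nlinarith

/-- Unless the partition is itself a good cut, the fluctuations of the two random cuts pay for the
private selection. -/
theorem half_add_half_le_partitionValue (α : ℝ) {ε : ℝ} (hε : 0 < ε) (G : SimpleGraph V)
    (V₁ : Finset V) (hm : 4000000 / ε ^ 2 ≤ ((edges G).card : ℝ))
    (hcross : ((edges G).card : ℝ) - (insideEdges G (· ∈ V₁)).card -
      (insideEdges G (· ∉ V₁)).card ≤ 0.55 * (edges G).card) :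
    1 / 2 * (mean (highCut ε G V₁) fun x => (cutValue G x : ℝ)) +
        1 / 2 * (mean (lowCut α ε G V₁) fun x => (cutValue G x : ℝ)) ≤
      partitionValue α ε G V₁ := by
  set m : ℝ := ((edges G).card : ℝ) with hmdef
  have hpen := five_div_le hm
  -- If at most `0.55 m` edges cross, one part contains at least `0.225 m`. As `0.225 ≥ 0.25²`, half
  -- of its fluctuation is at least `√m / 400`, the bound on the selection loss in `five_div_le`.
  have hsqrt : ∀ k : ℝ, 0.225 * m ≤ k → Real.sqrt m / 400 ≤ 1 / 2 * (Real.sqrt k / 50) := by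
    intro k hk
    have h1 : Real.sqrt m * 0.25 ≤ Real.sqrt k := by
      have h2 : Real.sqrt m * 0.25 = Real.sqrt (m * 0.25 ^ 2) := by
        rw [Real.sqrt_mul' _ (by norm_num), Real.sqrt_sq (by norm_num)]
      rw [h2]
      refine Real.sqrt_le_sqrt (le_trans ?_ hk)
      have : 0 ≤ m := Nat.cast_nonneg _
      linarith
    linarith
  rcases le_total (0.225 * m) ((insideEdges G (· ∉ V₁)).card : ℝ) with h | h
  · have h1 := average_le_partitionValue α hε G V₁ (fluctuation_low α ε G V₁)
    have h2 := hsqrt _ h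
    linarith
  · have h1 := average_le_partitionValue α hε G V₁ (fluctuation_high α ε G V₁)
    have h2 := hsqrt ((insideEdges G (· ∈ V₁)).card : ℝ) (by linarith)
    linarith

/-- On the vertices of high degree the exponential mechanism finds a nearly maximum cut. -/
theorem le_mean_highCut {ε : ℝ} (hε : 0 < ε) (G : SimpleGraph V) (V₁ : Finset V) :
    (maxCutValue (inducedOn G (· ∈ V₁)) : ℝ) -
        8.4 / ε * (activeVertices (inducedOn G (· ∈ V₁))).card +
        1 / 2 * (((edges G).card : ℝ) - (insideEdges G (· ∈ V₁)).card) ≤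
      mean (highCut ε G V₁) fun x => (cutValue G x : ℝ) := by
  have h := maxCutValue_sub_le_mean_expMechanism (inducedOn G (· ∈ V₁)) (r := ε / 12)
    (by positivity)
  rw [mean_highCut]
  have hlog : Real.log 2 * (activeVertices (inducedOn G (· ∈ V₁))).card / (ε / 12) ≤
      8.4 / ε * (activeVertices (inducedOn G (· ∈ V₁))).card := by
    rw [div_div_eq_mul_div, div_mul_eq_mul_div]
    refine div_le_div_of_nonneg_right ?_ hε.le
    have h2 : Real.log 2 ≤ 0.7 := Real.log_two_lt_d9.le.trans (by norm_num)
    have h3 : (0 : ℝ) ≤ (activeVertices (inducedOn G (· ∈ V₁))).card := Nat.cast_nonneg _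
    nlinarith
  linarith

theorem half_le_mean_lowCut {α ε : ℝ} (hη : 0 < ε ^ (1 + α)) (hη1 : ε ^ (1 + α) ≤ 1)
    (G : SimpleGraph V) (V₁ : Finset V) :
    1 / 2 * ((edges G).card : ℝ) ≤ mean (lowCut α ε G V₁) fun x => (cutValue G x : ℝ) := by
  refine le_trans ?_ (le_mean_lowCut hη hη1 G V₁)
  have : (0 : ℝ) ≤ (insideEdges G (· ∉ V₁)).card -
      (highInLow G (45.6 / ε ^ (1 + α)) V₁).card := by
    rw [sub_nonneg]
    exact_mod_cast Finset.card_filter_le _ _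
  have := mul_nonneg (show 0 ≤ ε ^ (1 + α) / 15000 by positivity) this
  linarith

/-- The fallback for bad partitions: without any assumption on misplaced vertices, nothing is lost
against `m/2`. -/
theorem half_le_partitionValue {α ε : ℝ} (hε : 0 < ε) (hε1 : ε ≤ 0.1) (hη : 0 < ε ^ (1 + α))
    (hη1 : ε ^ (1 + α) ≤ 1) (G : SimpleGraph V) (V₁ : Finset V)
    (hm : 4000000 / ε ^ 2 ≤ ((edges G).card : ℝ)) :
    1 / 2 * ((edges G).card : ℝ) ≤ partitionValue α ε G V₁ := by
  rcases le_total (((edges G).card : ℝ) - (insideEdges G (· ∈ V₁)).card -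
      (insideEdges G (· ∉ V₁)).card) (0.55 * (edges G).card) with h | h
  · have h1 := half_add_half_le_partitionValue α hε G V₁ hm h
    have h2 := half_le_mean_highCut hε.le G V₁
    have h3 := half_le_mean_lowCut hη hη1 G V₁
    linarith
  · have h1 := cross_le_partitionValue α hε G V₁
    have h2 := five_div_le_mul hε hε1 hm
    have : (0 : ℝ) ≤ (edges G).card := Nat.cast_nonneg _
    linarith

/-- The conclusion contains an extra `η m / 2000000` beyond the target; it is the reserve that later
pays for the bad partitions. -/
theorem target_le_partitionValue {α ε : ℝ} (hε : 0 < ε) (hε1 : ε ≤ 0.1)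
    (hη : 0 < ε ^ (1 + α)) (hη1 : ε ^ (1 + α) ≤ 0.0106 * ε) (G : SimpleGraph V) (V₁ : Finset V)
    (hm : 4000000 / ε ^ 2 ≤ ((edges G).card : ℝ))
    (hlow : ((lowInHigh G (2.4 / ε ^ (1 + α)) V₁).card : ℝ) ≤
      0.25 * ε ^ (1 + α) * (edges G).card)
    (hhigh : ((highInLow G (45.6 / ε ^ (1 + α)) V₁).card : ℝ) ≤ 0.01 * (edges G).card) :
    (1 / 2 + 1 / 2000000 * ε ^ (1 + α)) * maxCutValue G +
      1 / 2000000 * ε ^ (1 + α) * (edges G).card ≤ partitionValue α ε G V₁ := by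
  set η := ε ^ (1 + α) with hηdef
  have hmax : (maxCutValue G : ℝ) ≤ (edges G).card := by exact_mod_cast maxCutValue_le_card G
  have hcross := cross_le_partitionValue α hε G V₁
  have havg := half_add_half_le_partitionValue α hε G V₁ hm
  have hhalf := half_le_mean_highCut hε.le G V₁
  have hgain := le_mean_lowCut (α := α) (ε := ε) hη (by linarith) G V₁
  have hsel := mean_highCut_le_partitionValue α hε G V₁
  have hexp := le_mean_highCut hε G V₁
  have hact := mul_card_activeVertices_le G (t := 2.4 / η) (by positivity) V₁
  have hadd := maxCutValue_le_add G V₁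
  have hhalfmax := half_le_maxCutValue (inducedOn G (· ∈ V₁))
  rw [card_edges_inducedOn] at hhalfmax
  have hpen := five_div_le_mul hε hε1 hm
  rw [← hηdef] at hgain
  set m : ℝ := ((edges G).card : ℝ) with hmdef
  set a : ℝ := ((insideEdges G (· ∈ V₁)).card : ℝ) with ha
  set d : ℝ := ((insideEdges G (· ∉ V₁)).card : ℝ) with hd
  set k : ℝ := ((activeVertices (inducedOn G (· ∈ V₁))).card : ℝ) with hk
  set B₁ : ℝ := ((lowInHigh G (2.4 / η) V₁).card : ℝ) with hB₁
  set B₂ : ℝ := ((highInLow G (45.6 / η) V₁).card : ℝ) with hB₂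
  set O : ℝ := (maxCutValue G : ℝ) with hO
  set O₁ : ℝ := (maxCutValue (inducedOn G (· ∈ V₁)) : ℝ) with hO₁
  have hm0 : 0 ≤ m := Nat.cast_nonneg _
  have ha0 : 0 ≤ a := Nat.cast_nonneg _
  have hd0 : 0 ≤ d := Nat.cast_nonneg _
  have hηm : η * O ≤ η * m := mul_le_mul_of_nonneg_left hmax hη.le
  have hη2 : η ≤ 0.00106 := by linarith
  have hηm2 : η * m ≤ 0.00106 * m := mul_le_mul_of_nonneg_right hη2 hm0
  rcases le_total (m - a - d) (0.55 * m) with hb | hb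
  · rcases le_total (0.05 * m) d with hdm | hdm
    · have h1 := havg hb
      -- At most `0.01 m` of the `d ≥ 0.05 m` edges have a high-degree endpoint. Half of the
      -- resulting gain is `η m / 750000`, more than the required `η m / 1000000`.
      have h2 : η / 15000 * (0.04 * m) ≤ η / 15000 * (d - B₂) :=
        mul_le_mul_of_nonneg_left (by linarith) (by positivity)
      linarith [mul_nonneg hη.le hm0]
    -- Now `a ≥ 0.4 m`. From `O ≤ O₁ + (m - a)` and `O₁ ≥ a/2`, the cut `S₁` exceeds `O/2` by at
    -- least `a/4`, apart from this vertex cost and the selection loss. The cost is small because `η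
    -- ≤ 0.0106 ε` turns `8.4 / (2.4 ε) * η` into at most `3.5 * 0.0106 = 0.0371`.
    · have hkle : 8.4 / ε * k ≤ 0.0371 * (0.6 * m + (m + a - d)) := by
        have h1 : k ≤ η / 2.4 * (0.6 * m + (m + a - d)) := by
          have h2 : η / 2.4 * (2.4 / η * k) ≤ η / 2.4 * (2.4 / η * B₁ + (m + a - d)) :=
            mul_le_mul_of_nonneg_left hact (by positivity)
          have e1 : η / 2.4 * (2.4 / η * k) = k := by field_simp
          have e2 : η / 2.4 * (2.4 / η * B₁) = B₁ := by field_simp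
          have e3 : η / 2.4 * (0.6 * m + (m + a - d)) =
              0.25 * η * m + η / 2.4 * (m + a - d) := by ring
          rw [e1, mul_add, e2] at h2
          rw [e3]
          linarith
        have h0 : 0 ≤ 0.6 * m + (m + a - d) := by linarith
        calc 8.4 / ε * k ≤ 8.4 / ε * (η / 2.4 * (0.6 * m + (m + a - d))) := by gcongr
          _ = 3.5 / ε * (0.6 * m + (m + a - d)) * η := by ring
          _ ≤ 3.5 / ε * (0.6 * m + (m + a - d)) * (0.0106 * ε) := by gcongr
          _ = 0.0371 * (0.6 * m + (m + a - d)) := by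
            field_simp
            ring
      linarith
  · linarith

/-- Averages over the partition. Failures are charged linearly in the two counts, as in Markov's
inequality, so only their expectations are needed. -/
theorem target_le_integral {α ε : ℝ} (hα : 0 < α) (hε : 0 < ε) (hε1 : ε ≤ 0.1)
    (hadm : Admissible α ε) (G : SimpleGraph V)
    (hm : 4000000 / ε ^ 2 ≤ ((edges G).card : ℝ)) :
    (1 / 2 + 1 / 2000000 * ε ^ (1 + α)) * maxCutValue G ≤
      ∫ x, (cutValue G x : ℝ) ∂(privateMaxCut α ε G) := by
  have hη : 0 < ε ^ (1 + α) := Real.rpow_pos_of_pos hε _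
  have hη1 : ε ^ (1 + α) ≤ 0.0106 * ε := by
    rw [Real.rpow_add hε, Real.rpow_one, mul_comm]
    exact mul_le_mul_of_nonneg_right (hadm.trans (min_le_left _ _)) hε.le
  have hmean₁ := mean_card_lowInHigh_le hε hε1 hα hadm G
  have hmean₂ := mean_card_highInLow_le hε hε1 hα hadm G
  have htarget := fun V₁ => target_le_partitionValue hε hε1 hη hη1 G V₁ hm
  have hhalf := fun V₁ => half_le_partitionValue hε hε1 hη (by linarith) G V₁ hm
  have hmax : (maxCutValue G : ℝ) ≤ (edges G).card := by exact_mod_cast maxCutValue_le_card G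
  rw [integral_privateMaxCut α hε]
  change _ ≤ mean _ fun V₁ => partitionValue α ε G V₁
  set η := ε ^ (1 + α) with hηdef
  set m : ℝ := ((edges G).card : ℝ) with hmdef
  have hm0 : 0 < m := lt_of_lt_of_le (by positivity) hm
  set T := (1 / 2 + 1 / 2000000 * η) * (maxCutValue G : ℝ) with hT
  have hTle : T ≤ 1 / 2 * m + 1 / 2000000 * η * m := by
    rw [hT]
    calc _ ≤ (1 / 2 + 1 / 2000000 * η) * m := by gcongr
      _ = _ := by ring
  -- The weights make either failure, `0.25 η m` or `0.01 m`, worth `η m / 1000000`, which reduces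
  -- the left side to `m/2`. In expectation the charges are `η m / 2500000` and a far smaller term,
  -- within the reserve `η m / 2000000`.
  have hpt : ∀ V₁, T + 1 / 2000000 * η * m +
      (-(1 / 250000) * ((lowInHigh G (2.4 / η) V₁).card : ℝ) +
        -(1 / 10000 * η) * ((highInLow G (45.6 / η) V₁).card : ℝ)) ≤ partitionValue α ε G V₁ := by
    intro V₁
    have h0 : (0 : ℝ) ≤ (lowInHigh G (2.4 / η) V₁).card := Nat.cast_nonneg _
    have h0' : 0 ≤ 1 / 10000 * η * ((highInLow G (45.6 / η) V₁).card : ℝ) := by positivity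
    by_cases h1 : ((lowInHigh G (2.4 / η) V₁).card : ℝ) ≤ 0.25 * η * m
    · by_cases h2 : ((highInLow G (45.6 / η) V₁).card : ℝ) ≤ 0.01 * m
      · have := htarget V₁ h1 h2
        linarith
      · have h3 : 1 / 10000 * η * (0.01 * m) ≤
            1 / 10000 * η * ((highInLow G (45.6 / η) V₁).card : ℝ) :=
          mul_le_mul_of_nonneg_left (not_le.1 h2).le (by positivity)
        have := hhalf V₁
        linarith
    · have := hhalf V₁
      linarith
  have hmean := mean_mono (partitionLaw α hε G) hpt
  simp only [add_comm (T + _), mean_add_const, mean_add, mean_const_mul] at hmean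
  have h3 : 1 / 10000 * η * mean (partitionLaw α hε G)
      (fun V₁ => ((highInLow G (45.6 / η) V₁).card : ℝ)) ≤ 1 / 10000 * η * (η / 20 * m) :=
    mul_le_mul_of_nonneg_left hmean₂ (by positivity)
  have h4 : η * (η * m) ≤ 0.00106 * (η * m) :=
    mul_le_mul_of_nonneg_right (by linarith) (by positivity)
  have h5 : 0 < η * m := by positivity
  linarith

end Utility

/-! ### The choice of the exponent -/

section Exponent

theorem two_le_log_inv {ε : ℝ} (hε : 0 < ε) (hε1 : ε ≤ 0.1) : 2 ≤ Real.log (1 / ε) := by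
  rw [Real.le_log_iff_exp_le (by positivity)]
  have h10 : (10 : ℝ) ≤ 1 / ε := by
    rw [le_div_iff₀ hε]
    linarith
  calc Real.exp 2 = Real.exp 1 ^ 2 := by rw [← Real.exp_nat_mul]; norm_num
    _ ≤ 2.7182818286 ^ 2 := by gcongr; exact Real.exp_one_lt_d9.le
    _ ≤ 10 := by norm_num
    _ ≤ _ := h10

theorem rpow_of_eq_logb {α ε : ℝ} (hε : 0 < ε) (hε1 : ε ≤ 0.1)
    (hα : α = Real.logb (1 / ε) (Real.log (1 / ε) / 0.0106)) :
    ε ^ α = 0.0106 / Real.log (1 / ε) := by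
  have hlog := two_le_log_inv hε hε1
  have h1 : 1 < 1 / ε := by
    rw [lt_div_iff₀ hε]
    linarith
  have h := Real.rpow_logb (b := 1 / ε) (by positivity) h1.ne'
    (show 0 < Real.log (1 / ε) / 0.0106 by positivity)
  rw [← hα, one_div, Real.inv_rpow hε.le] at h
  rw [← inv_inv (ε ^ α), h, inv_div, one_div]

theorem pos_of_eq_logb {α ε : ℝ} (hε : 0 < ε) (hε1 : ε ≤ 0.1)
    (hα : α = Real.logb (1 / ε) (Real.log (1 / ε) / 0.0106)) : 0 < α := by
  have hlog := two_le_log_inv hε hε1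
  rw [hα]
  refine Real.logb_pos ?_ ?_
  · rw [lt_div_iff₀ hε]
    linarith
  · rw [lt_div_iff₀ (by norm_num)]
    linarith

theorem rpow_one_add_of_eq_logb {α ε : ℝ} (hε : 0 < ε) (hε1 : ε ≤ 0.1)
    (hα : α = Real.logb (1 / ε) (Real.log (1 / ε) / 0.0106)) :
    ε ^ (1 + α) = 0.0106 * (ε / Real.log (1 / ε)) := by
  rw [Real.rpow_add hε, Real.rpow_one, rpow_of_eq_logb hε hε1 hα]
  ring

theorem admissible_of_eq_logb {α ε : ℝ} (hε : 0 < ε) (hε1 : ε ≤ 0.1)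
    (hα : α = Real.logb (1 / ε) (Real.log (1 / ε) / 0.0106)) : Admissible α ε := by
  have hlog := two_le_log_inv hε hε1
  rw [Admissible, rpow_one_add_of_eq_logb hε hε1 hα, rpow_of_eq_logb hε hε1 hα]
  set l := Real.log (1 / ε) with hl
  have hl0 : 0 < l := by linarith
  refine le_min ?_ ?_
  · rw [div_le_iff₀ hl0]
    linarith
  · have harg : 10 / (0.0106 * (ε / l)) = 10 / 0.0106 * (l * (1 / ε)) := by
      field_simp
    have hlogl : Real.log l ≤ l - 1 := Real.log_le_sub_one_of_pos hl0
    -- Crude bounds suffice: with `log l ≤ l - 1` the logarithm is at most `2l + 9`, and `0.0106 *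
    -- (2l + 9) ≤ 1.8 l` holds for `l ≥ 2`.
    have hlog10 : Real.log (10 / 0.0106) ≤ 10 := by
      rw [Real.log_le_iff_le_exp (by norm_num)]
      calc (10 / 0.0106 : ℝ) ≤ 2 ^ 10 := by norm_num
        _ ≤ Real.exp 1 ^ 10 := by
          gcongr
          have := Real.exp_one_gt_d9
          linarith
        _ = Real.exp 10 := by rw [← Real.exp_nat_mul]; norm_num
    have heq : Real.log (10 / (0.0106 * (ε / l))) =
        Real.log (10 / 0.0106) + (Real.log l + l) := by
      rw [harg, Real.log_mul (by norm_num) (by positivity), Real.log_mul hl0.ne' (by positivity)]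
    have hpos : 0 < Real.log (10 / (0.0106 * (ε / l))) := by
      refine Real.log_pos ?_
      rw [lt_div_iff₀ (by positivity), one_mul]
      have : ε / l ≤ ε := div_le_self hε.le (by linarith)
      linarith
    rw [div_le_div_iff₀ hl0 hpos, heq]
    linarith

end Exponent

end PrivateMaxCut

end

theorem mainTheorem4 :
    ∃ C c : ℝ, 0 < C ∧ 0 < c ∧
      (∀ α ε : ℝ, 0 < α → 0 < ε → ε ≤ 0.1 → PrivateMaxCut.Admissible α ε →
        ∀ n : ℕ,
          PrivateMaxCut.IsDP (PrivateMaxCut.EdgeNeighbors (V := Fin n))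
            (PrivateMaxCut.privateMaxCut α ε) ε 0 ∧
          ∀ G : SimpleGraph (Fin n), C / ε ^ 2 ≤ (PrivateMaxCut.edgeCount G : ℝ) →
            (1 / 2 + c * ε ^ (1 + α)) * (PrivateMaxCut.maxCutValue G : ℝ) ≤
              ∫ x, (PrivateMaxCut.cutValue G x : ℝ) ∂(PrivateMaxCut.privateMaxCut α ε G)) ∧
      (∀ α ε : ℝ, 0 < ε → ε ≤ 0.1 →
        α = Real.logb (1 / ε) (Real.log (1 / ε) / 0.0106) →
        0 < α ∧ PrivateMaxCut.Admissible α ε ∧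
        ε ^ (1 + α) = 0.0106 * (ε / Real.log (1 / ε)) ∧
        ∀ n : ℕ,
          PrivateMaxCut.IsDP (PrivateMaxCut.EdgeNeighbors (V := Fin n))
            (PrivateMaxCut.privateMaxCut α ε) ε 0 ∧
          ∀ G : SimpleGraph (Fin n), C / ε ^ 2 ≤ (PrivateMaxCut.edgeCount G : ℝ) →
            (1 / 2 + c * (ε / Real.log (1 / ε))) * (PrivateMaxCut.maxCutValue G : ℝ) ≤
              ∫ x, (PrivateMaxCut.cutValue G x : ℝ) ∂(PrivateMaxCut.privateMaxCut α ε G)) := by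
  -- One `c` must serve both parts: the factor `0.0106` is the constant in `ε ^ (1 + α) = 0.0106 *
  -- (ε / log (1/ε))`, needed in the second part and mere slack in the first.
  refine ⟨4000000, 1 / 2000000 * 0.0106, by norm_num, by norm_num, ?_, ?_⟩
  · intro α ε hα hε hε1 hadm n
    have hη : 0 < ε ^ (1 + α) := Real.rpow_pos_of_pos hε _
    refine ⟨PrivateMaxCut.isDP_privateMaxCut hε hε1 ?_, fun G hm => ?_⟩
    · rw [Real.rpow_add hε, Real.rpow_one, mul_comm]
      exact mul_le_mul_of_nonneg_right (hadm.trans (min_le_left _ _)) hε.le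
    · rw [PrivateMaxCut.edgeCount_eq_card] at hm
      refine le_trans ?_ (PrivateMaxCut.target_le_integral hα hε hε1 hadm G hm)
      refine mul_le_mul_of_nonneg_right ?_ (Nat.cast_nonneg _)
      linarith
  · intro α ε hε hε1 hαeq
    have hα := PrivateMaxCut.pos_of_eq_logb hε hε1 hαeq
    have hadm := PrivateMaxCut.admissible_of_eq_logb hε hε1 hαeq
    have hpow := PrivateMaxCut.rpow_one_add_of_eq_logb hε hε1 hαeq
    refine ⟨hα, hadm, hpow, fun n => ⟨PrivateMaxCut.isDP_privateMaxCut hε hε1 ?_, fun G hm => ?_⟩⟩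
    · rw [Real.rpow_add hε, Real.rpow_one, mul_comm]
      exact mul_le_mul_of_nonneg_right (hadm.trans (min_le_left _ _)) hε.le
    · rw [PrivateMaxCut.edgeCount_eq_card] at hm
      refine le_trans (le_of_eq ?_) (PrivateMaxCut.target_le_integral hα hε hε1 hadm G hm)
      rw [hpow]
      ring
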